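/- Let $m\le n$ be natural numbers, let $\pi:\{1,\dots,m\}\to\{1,\dots,n\}$ be injective, and let $\beta\in\{\mathsf W,\mathsf E\}^m$ assign to each row $i$ (counted from the top) of an $m\times n$ grid of squares a type, West or East. A *nongeneric hybrid pipe dream* of type $\beta$ is a filling of the grid by the following tiles. In rows of either type one may use the blank tile, the horizontal tile (one strand joining the West and East sides) and the crossing tile (one strand joining West and East, one joining South and North). In rows of type $\mathsf W$ one may moreover use the elbow joining West and North, the elbow joining South and East, and the tile containing both of these elbows. In rows of type $\mathsf E$ one may moreover use the elbow joining East and North, the elbow joining South and West, and the vertical tile (one strand joining South and North). It is required that the strands form pipes such that * no pipe starts or terminates in the middle of the grid; * no two pipes cross (in a crossing tile) more than once; * in each row of type $\mathsf W$ a pipe enters from the West end and none exits from the East end; in each row of type $\mathsf E$ a pipe enters from the East end and none exits from the West end; * no pipe comes in from the South side. Thus exactly one pipe enters in each row, and each pipe exits on the North side. Number the pipes $1,\dots,m$ by their entry points, counterclockwise along the West and East sides starting from the Northwest corner (down the West side, then up the East side), and let $\varphi(i)$ be the number of the pipe entering in row $i$. The pipe dream has *connectivity* $\pi$ if for every $k$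 the pipe numbered $k$ exits the North side in column $\pi(k)$. Let $S_\pi\in\mathbb Z[x_1,\dots,x_m,y_1,\dots,y_n]$ be the sum, over all nongeneric hybrid pipe dreams of type $\beta$ with connectivity $\pi$, of the product over all positions $(i,j)$ of the following factors: $x_{\varphi(i)}-y_j$ if row $i$ has type $\mathsf W$ and the tile at $(i,j)$ is straight (horizontal or crossing); $x_{\varphi(i)}-y_j$ if row $i$ has type $\mathsf E$ and the tile at $(i,j)$ is blank; and $1$ otherwise. Let $\hat\pi\in\mathcal S_n$ be the minimal extension of $\pi$: $\hat\pi(i)=\pi(i)$ for $1\le i\le m$ and $\hat\pi(m+k)=j_k$ for $1\le k\le n-m$, where $j_1<\dots<j_{n-m}$ are the elements of $\{1,\dots,n\}$ not in the image of $\pi$. Double Schubert polynomials $\mathfrak S_w\in\mathbb Z[x_1,\dots,x_n,y_1,\dots,y_n]$, $w\in\mathcal S_n$, are determined by $\mathfrak S_{w_0}=\prod_{i+j\le n}(x_i-y_j)$ for $w_0=(n,n-1,\dots,1)$ and $\mathfrak S_w=\partial_i\,\mathfrak S_{w r_i}$ whenever $w(i)<w(i+1)$, where $r_i=(i\ \,i{+}1)$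 and $\partial_i f=(f-r_if)/(x_i-x_{i+1})$, with $r_i$ exchanging $x_i$ and $x_{i+1}$. **Proposition.** For every $\beta\in\{\mathsf W,\mathsf E\}^m$, one has $S_\pi=\mathfrak S_{\hat\pi}$ in $\mathbb Z[x_1,\dots,x_n,y_1,\dots,y_n]$. -/

import Mathlib

open Finset

namespace HybridPipeDream

/-! ### Tiles -/

/-- The type of a row: pipes enter a row of type `west` from the West, and a row of type `east`
from the East. -/
inductive RowType
  | west
  | east
  deriving DecidableEq

/-- The four sides of a square tile. -/
inductive Side
  | N
  | E
  | S
  | W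
  deriving DecidableEq

/-- The side of the neighbouring tile that is glued to a given side. -/
def Side.opp : Side → Side
  | .N => .S
  | .E => .W
  | .S => .N
  | .W => .E

/-- The ten tiles. An elbow is named after the two sides that it joins. -/
inductive Tile
  | blank
  | horiz
  | vert
  | cross
  | elbowWN
  | elbowSE
  | bumpWNSE
  | elbowEN
  | elbowSW
  | bumpENSW
  deriving DecidableEq

instance : Fintype Tile where
  elems := {.blank, .horiz, .vert, .cross, .elbowWN, .elbowSE, .bumpWNSE, .elbowEN, .elbowSW,
    .bumpENSW}
  complete t := by cases t <;> simp

/-- `t.other s` is the side at the other end of the strand of the tile `t` that touches the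
side `s`, and `none` if no strand touches `s`. -/
def Tile.other : Tile → Side → Option Side
  | .blank, _ => none
  | .horiz, .W => some .E
  | .horiz, .E => some .W
  | .horiz, _ => none
  | .vert, .S => some .N
  | .vert, .N => some .S
  | .vert, _ => none
  | .cross, s => some s.opp
  | .elbowWN, .W => some .N
  | .elbowWN, .N => some .W
  | .elbowWN, _ => none
  | .elbowSE, .S => some .E
  | .elbowSE, .E => some .S
  | .elbowSE, _ => none
  | .bumpWNSE, .W => some .N
  | .bumpWNSE, .N => some .W
  | .bumpWNSE, .S => some .E
  | .bumpWNSE, .E => some .S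
  | .elbowEN, .E => some .N
  | .elbowEN, .N => some .E
  | .elbowEN, _ => none
  | .elbowSW, .S => some .W
  | .elbowSW, .W => some .S
  | .elbowSW, _ => none
  | .bumpENSW, .E => some .N
  | .bumpENSW, .N => some .E
  | .bumpENSW, .S => some .W
  | .bumpENSW, .W => some .S

/-- The side `s` of the tile `t` is touched by a pipe. -/
def Tile.Touches (t : Tile) (s : Side) : Prop := t.other s ≠ none

/-- The straight tiles. -/
def Tile.IsStraight : Tile → Prop
  | .cross => True
  | .horiz => True
  | .vert => True
  | _ => False

/-- The tiles that a nongeneric hybrid pipe dream may use in a row of the given type: in rows of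
type `west` the vertical tile is forbidden, in rows of type `east` the double elbow is. -/
def Tile.Allowed : RowType → Tile → Prop
  | .west, .bumpWNSE => True
  | .west, .elbowWN => True
  | .west, .elbowSE => True
  | .west, .cross => True
  | .west, .horiz => True
  | .west, .blank => True
  | .east, .elbowSW => True
  | .east, .elbowEN => True
  | .east, .cross => True
  | .east, .horiz => True
  | .east, .vert => True
  | .east, .blank => True
  | _, _ => False

/-! ### Fillings and their pipes -/

/-- A filling of the `m × n` grid; row `0` is the top row, column `0` the leftmost column. -/
abbrev Filling (m n : ℕ) := Fin m → Fin n → Tile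

/-- `Neighbor s i j i' j'`: the cell `(i', j')` is glued to the side `s` of the cell `(i, j)`. -/
def Neighbor {m n : ℕ} (s : Side) (i : Fin m) (j : Fin n) (i' : Fin m) (j' : Fin n) : Prop :=
  match s with
  | .N => i'.val + 1 = i.val ∧ j' = j
  | .S => i'.val = i.val + 1 ∧ j' = j
  | .E => i' = i ∧ j'.val = j.val + 1
  | .W => i' = i ∧ j'.val + 1 = j.val

/-- A place on a pipe: the pipe enters the tile in position `(row, col)` through `side`. -/
structure Place (m n : ℕ) where
  row : Fin m
  col : Fin n
  side : Side

/-- The pipe that is at the place `p` leaves the tile there and is next at the place `q`. -/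
def Step {m n : ℕ} (D : Filling m n) (p q : Place m n) : Prop :=
  ∃ s : Side, (D p.row p.col).other p.side = some s ∧
    Neighbor s p.row p.col q.row q.col ∧ q.side = s.opp

/-- `p` is the place where the pipe of row `r` enters the grid. -/
def IsEntry {m n : ℕ} (β : Fin m → RowType) (r : Fin m) (p : Place m n) : Prop :=
  p.row = r ∧
    ((β r = .west ∧ p.col.val = 0 ∧ p.side = .W) ∨
      (β r = .east ∧ p.col.val + 1 = n ∧ p.side = .E))

/-- The pipe that enters the grid in row `r` passes through the place `p`. -/
def Visits {m n : ℕ} (β : Fin m → RowType) (D : Filling m n) (r : Fin m) (p : Place m n) : Prop :=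
  ∃ p₀ : Place m n, IsEntry β r p₀ ∧ Relation.ReflTransGen (Step D) p₀ p

/-- The pipe that enters the grid in row `r` leaves it on the North side, in column `c`. -/
def ExitsAt {m n : ℕ} (β : Fin m → RowType) (D : Filling m n) (r : Fin m) (c : Fin n) : Prop :=
  ∃ p : Place m n, Visits β D r p ∧ p.row.val = 0 ∧ p.col = c ∧
    (D p.row p.col).other p.side = some .N

/-- The pipes that enter the grid in rows `r` and `r'` cross in the tile `(i, j)`. -/
def CrossAt {m n : ℕ} (β : Fin m → RowType) (D : Filling m n) (r r' : Fin m)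
    (i : Fin m) (j : Fin n) : Prop :=
  r ≠ r' ∧ D i j = .cross ∧ (∃ s, Visits β D r ⟨i, j, s⟩) ∧ (∃ s, Visits β D r' ⟨i, j, s⟩)

/-- Nongeneric hybrid pipe dreams of type `β`. -/
structure IsHybridPipeDream {m n : ℕ} (β : Fin m → RowType) (D : Filling m n) : Prop where
  /-- Only the tiles allowed in the row are used. -/
  allowed : ∀ i j, (D i j).Allowed (β i)
  /-- No pipe starts or terminates in the middle of the grid. -/
  matching : ∀ s i j i' j', Neighbor s i j i' j' →
    ((D i j).Touches s ↔ (D i' j').Touches s.opp)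
  /-- In rows of type `west`, a pipe enters from the West end, in rows of type `east`, no pipe
  exits there. -/
  west_end : ∀ i j, j.val = 0 → ((D i j).Touches .W ↔ β i = .west)
  /-- In rows of type `east`, a pipe enters from the East end, in rows of type `west`, no pipe
  exits there. -/
  east_end : ∀ i j, j.val + 1 = n → ((D i j).Touches .E ↔ β i = .east)
  /-- No pipe comes in from the South side. -/
  south_end : ∀ i j, i.val + 1 = m → ¬ (D i j).Touches .S
  /-- No two pipes cross twice. -/
  no_double_crossing : ∀ r r' i j i' j', CrossAt β D r r' i j → CrossAt β D r r' i' j' →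
    i = i' ∧ j = j'

/-! ### Numbering of the pipes, connectivity, and the sum over pipe dreams -/

/-- Going counterclockwise around the grid from its Northwest corner (down the West side and then
up the East side), the entry of row `r'` is met before the entry of row `r`. -/
def EntersBefore {m : ℕ} (β : Fin m → RowType) (r' r : Fin m) : Prop :=
  match β r', β r with
  | .west, .west => r' < r
  | .west, .east => True
  | .east, .west => False
  | .east, .east => r < r'

theorem not_entersBefore_self {m : ℕ} (β : Fin m → RowType) (r : Fin m) :
    ¬ EntersBefore β r r := by
  unfold EntersBefore
  cases h : β r <;> simp

open Classical in
/-- The number (counted from `0`) of the pipe that enters the grid in row `r`, where the pipes are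
numbered counterclockwise along the West and East sides, starting from the Northwest corner. -/
noncomputable def pipeNumber {m : ℕ} (β : Fin m → RowType) (r : Fin m) : Fin m :=
  ⟨(univ.filter fun r' => EntersBefore β r' r).card, by
    have h : (univ.filter fun r' => EntersBefore β r' r) ⊂ univ :=
      Finset.filter_ssubset.2 ⟨r, mem_univ r, not_entersBefore_self β r⟩
    simpa using Finset.card_lt_card h⟩

/-- The connectivity of the filling is `π`: the pipe numbered `k` exits the North side in
column `π k`. -/
def HasConnectivity {m n : ℕ} (β : Fin m → RowType) (D : Filling m n) (π : Fin m ↪ Fin n) : Prop :=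
  ∀ r : Fin m, ExitsAt β D r (π (pipeNumber β r))

open MvPolynomial in
open Classical in
/-- The factor contributed by a tile in row `i` and column `j`, in the polynomial ring in the
variables `x k = X (Sum.inl k)` and `y j = X (Sum.inr j)`. -/
noncomputable def tileWeight {m n : ℕ} (β : Fin m → RowType) (i : Fin m) (j : Fin n) (t : Tile) :
    MvPolynomial (Fin m ⊕ Fin n) ℤ :=
  match β i with
  | .west => if t.IsStraight then X (Sum.inl (pipeNumber β i)) - X (Sum.inr j) else 1
  | .east => if t = .blank then X (Sum.inl (pipeNumber β i)) - X (Sum.inr j) else 1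

open Classical in
/-- The sum `S_π` over the nongeneric hybrid pipe dreams of type `β` with connectivity `π`. -/
noncomputable def pipeDreamSum {m n : ℕ} (β : Fin m → RowType) (π : Fin m ↪ Fin n) :
    MvPolynomial (Fin m ⊕ Fin n) ℤ :=
  ∑ D ∈ (univ : Finset (Filling m n)).filter
      (fun D => IsHybridPipeDream β D ∧ HasConnectivity β D π),
    ∏ i, ∏ j, tileWeight β i j (D i j)

/-! ### The minimal extension -/

/-- The columns that are not in the image of `π`. -/
def zeroColumns {m n : ℕ} (π : Fin m ↪ Fin n) : Finset (Fin n) := (univ.map π)ᶜ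

theorem card_zeroColumns {m n : ℕ} (π : Fin m ↪ Fin n) : (zeroColumns π).card = n - m := by
  simp [zeroColumns, card_compl]

/-- The one-line notation of the minimal extension: first the values of `π`, then the columns not
in the image of `π`, in increasing order. -/
def minimalExtensionFun {m n : ℕ} (π : Fin m ↪ Fin n) (i : Fin n) : Fin n :=
  if h : i.val < m then π ⟨i.val, h⟩
  else (zeroColumns π).orderEmbOfFin (card_zeroColumns π) ⟨i.val - m, by omega⟩

theorem minimalExtensionFun_injective {m n : ℕ} (π : Fin m ↪ Fin n) :
    Function.Injective (minimalExtensionFun π) := by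
  have key : ∀ (k : Fin m) (l : Fin (n - m)),
      π k ≠ (zeroColumns π).orderEmbOfFin (card_zeroColumns π) l := by
    intro k l h
    have h1 := (zeroColumns π).orderEmbOfFin_mem (card_zeroColumns π) l
    rw [← h] at h1
    simp [zeroColumns] at h1
  intro a b hab
  unfold minimalExtensionFun at hab
  split_ifs at hab with ha hb hb
  · have := π.injective hab
    simp only [Fin.mk.injEq] at this
    exact Fin.ext this
  · exact absurd hab (key _ _)
  · exact absurd hab.symm (key _ _)
  · have := ((zeroColumns π).orderEmbOfFin (card_zeroColumns π)).injective hab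
    simp only [Fin.mk.injEq] at this
    exact Fin.ext (by omega)

/-- The minimal extension of `π` to a permutation. -/
noncomputable def minimalExtension {m n : ℕ} (π : Fin m ↪ Fin n) : Equiv.Perm (Fin n) :=
  Equiv.ofBijective (minimalExtensionFun π)
    (Finite.injective_iff_bijective.1 (minimalExtensionFun_injective π))

end HybridPipeDream

/-! ### Double Schubert polynomials -/

namespace DoubleSchubert

open MvPolynomial

/-- Exchange of the variables `x i` and `x j`. -/
noncomputable def swapX {n : ℕ} (i j : Fin n) (f : MvPolynomial (Fin n ⊕ Fin n) ℤ) :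
    MvPolynomial (Fin n ⊕ Fin n) ℤ :=
  rename (Sum.map (Equiv.swap i j) id) f

theorem sub_dvd_sub_swapX {n : ℕ} (i j : Fin n) (f : MvPolynomial (Fin n ⊕ Fin n) ℤ) :
    (X (Sum.inl i) - X (Sum.inl j) : MvPolynomial (Fin n ⊕ Fin n) ℤ) ∣ f - swapX i j f := by
  induction f using MvPolynomial.induction_on with
  | C a => simp [swapX]
  | add p q hp hq =>
    have : p + q - swapX i j (p + q) = (p - swapX i j p) + (q - swapX i j q) := by
      simp only [swapX, map_add]; ring
    rw [this]; exact dvd_add hp hq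
  | mul_X p k hp =>
    have : p * X k - swapX i j (p * X k) =
        (p - swapX i j p) * X k + swapX i j p * (X k - swapX i j (X k)) := by
      simp only [swapX, map_mul]; ring
    rw [this]
    refine dvd_add (hp.mul_right _) (Dvd.dvd.mul_left ?_ _)
    rcases k with k | k
    · by_cases h1 : k = i
      · subst h1; simp [swapX]
      · by_cases h2 : k = j
        · subst h2
          simp only [swapX, rename_X, Sum.map_inl, Equiv.swap_apply_right]
          exact (dvd_sub_comm).1 dvd_rfl
        · simp [swapX, Equiv.swap_apply_of_ne_of_ne h1 h2]
    · simp [swapX]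

/-- The divided difference `(f - f with x i and x j exchanged) / (x i - x j)`. For `i ≠ j` it is
the unique polynomial `g` such that `f - swapX i j f = (x i - x j) * g`. -/
noncomputable def dividedDifference {n : ℕ} (i j : Fin n)
    (f : MvPolynomial (Fin n ⊕ Fin n) ℤ) : MvPolynomial (Fin n ⊕ Fin n) ℤ :=
  (sub_dvd_sub_swapX i j f).choose

/-- `p` is a pair of consecutive positions `i`, `i + 1`, and `w` has an ascent there. -/
def IsAscent {n : ℕ} (w : Equiv.Perm (Fin n)) (p : Fin n × Fin n) : Prop :=
  p.2.val = p.1.val + 1 ∧ w p.1 < w p.2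

theorem IsAscent.measure_lt {n : ℕ} {w : Equiv.Perm (Fin n)} {p : Fin n × Fin n}
    (h : IsAscent w p) :
    ∑ a, a.val * ((w * Equiv.swap p.1 p.2) a).val < ∑ a, a.val * (w a).val := by
  obtain ⟨i, j⟩ := p
  obtain ⟨h1, h2⟩ := h
  simp only at h1 h2 ⊢
  have hij : i ≠ j := fun e => by rw [e] at h1; omega
  have hj : j ∈ univ.erase i := by simp [hij.symm]
  rw [← Finset.add_sum_erase _ _ (mem_univ i), ← Finset.add_sum_erase _ _ hj,
    ← Finset.add_sum_erase _ (fun a => a.val * (w a).val) (mem_univ i),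
    ← Finset.add_sum_erase _ (fun a => a.val * (w a).val) hj]
  have hs : ∑ a ∈ (univ.erase i).erase j, a.val * ((w * Equiv.swap i j) a).val =
      ∑ a ∈ (univ.erase i).erase j, a.val * (w a).val := by
    refine Finset.sum_congr rfl fun a ha => ?_
    simp only [mem_erase, mem_univ, and_true] at ha
    rw [Equiv.Perm.mul_apply, Equiv.swap_apply_of_ne_of_ne ha.2 ha.1]
  rw [hs]
  simp only [Equiv.Perm.mul_apply, Equiv.swap_apply_left, Equiv.swap_apply_right]
  have h3 : (w i).val < (w j).val := h2
  rw [h1]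
  nlinarith

open Classical in
/-- The double Schubert polynomial of `w`: for the longest permutation (the one without ascents)
it is the product of the `x i - y j` with `i + j ≤ n` (for indices counted from `1`), and if `w`
has an ascent in positions `i, i + 1` it is the divided difference, with respect to `x i` and
`x (i + 1)`, of the double Schubert polynomial of `w * (i i+1)`. (The result does not depend on
the ascents that are used.) Here `x i = X (Sum.inl i)` and `y j = X (Sum.inr j)`. -/
noncomputable def doubleSchubert {n : ℕ} (w : Equiv.Perm (Fin n)) :
    MvPolynomial (Fin n ⊕ Fin n) ℤ :=
  if h : ∃ p : Fin n × Fin n, IsAscent w p then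
    dividedDifference h.choose.1 h.choose.2
      (doubleSchubert (w * Equiv.swap h.choose.1 h.choose.2))
  else
    ∏ p ∈ (univ : Finset (Fin n × Fin n)).filter (fun p => p.1.val + p.2.val + 2 ≤ n),
      (X (Sum.inl p.1) - X (Sum.inr p.2))
termination_by ∑ a, a.val * (w a).val
decreasing_by exact h.choose_spec.measure_lt

end DoubleSchubert

/-!
The pipes are recorded by labels on the edges of the grid, `⊤` standing for the absence of a pipe.
With the pipes labelled by their numbers, reading the labels along a path that sweeps across the
grid from the bottom to the top, one tile at a time, shows that no two pipes cross twice if and only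
if any two pipes that cross in a tile come in uncrossed, in the order of their labels. This makes
`S_π` the partition function of a lattice model with local weights, whose North boundary encodes
`π`.

The local form of the model satisfies a Yang–Baxter equation in the column variables `y`, so for
`m = n` the partition function satisfies the same exchange relation in `y j, y (j + 1)` as the
double Schubert polynomials, while for the longest permutation there is a single configuration, of
weight `∏ (x i - y j)`; together these determine the double Schubert polynomials. For `m < n`,
adding rows of type East on top of the grid, where the extra pipes have no freedom because the
extension is minimal, reduces to the case `m = n`.
-/

namespace HybridPipeDream

/-! ### Row sums and the partition function -/

section Lattice

variable {R : Type*} [CommRing R] {ι : Type*} [LinearOrder ι]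

/-- The sum, over the fillings of a row of type `west`, of the weight times the value of `F` at the
labels on the South side and the label on the West end. Edges carry the labels of their pipes, `⊤`
standing for an edge without pipe; the list holds the labels on the North side, and the label on
the East end is `⊤`. -/
def westRow (x : R) : (ℕ → R) → List (WithTop ι) → (List (WithTop ι) → WithTop ι → R) → R
  | _, [], F => F [] ⊤
  | y, n :: l, F => westRow x (fun k => y (k + 1)) l
      (fun s h => F (h :: s) n + if h < n then (x - y 0) * F (n :: s) h else 0)

/-- The sum, over the fillings of a row of type `east` with label `h` on its West end, of the weight
times the value of `F` at the labels on the South side and the label on the East end. -/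
def eastRow (x : R) :
    (ℕ → R) → List (WithTop ι) → WithTop ι → (List (WithTop ι) → WithTop ι → R) → R
  | _, [], h, F => F [] h
  | y, n :: l, h, F =>
    if h = ⊤ ∧ n = ⊤ then (x - y 0) * eastRow x (fun k => y (k + 1)) l ⊤ (fun s => F (⊤ :: s))
    else (if n = ⊤ ∨ n < h then eastRow x (fun k => y (k + 1)) l h (fun s => F (n :: s)) else 0) +
      if h = ⊤ ∨ n = ⊤ then eastRow x (fun k => y (k + 1)) l n (fun s => F (h :: s)) else 0

/-- The sum, over the fillings of a row of type `b` from which no pipe exits at an end, of the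
weight times the value of `F` at the labels on the South side and the label of the entering pipe. -/
def rowSum (b : RowType) (x : R) (y : ℕ → R) (l : List (WithTop ι))
    (F : List (WithTop ι) → WithTop ι → R) : R :=
  match b with
  | .west => westRow x y l F
  | .east => eastRow x y l ⊤ F

/-- The partition function of the lattice model: the sum over the fillings with prescribed labels
on the North side and no pipe on the South side. A row is given by its type and the label of the
pipe that enters it. -/
def partitionFn (x : ι → R) (y : ℕ → R) : List (RowType × ι) → List (WithTop ι) → R
  | [], l => if ∀ a ∈ l, a = ⊤ then 1 else 0
  | (b, a) :: rows, l => rowSum b (x a) y l fun s h => if h = a then partitionFn x y rows s else 0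

theorem westRow_add (x : R) (y : ℕ → R) (l : List (WithTop ι))
    (F G : List (WithTop ι) → WithTop ι → R) :
    westRow x y l (fun s h => F s h + G s h) = westRow x y l F + westRow x y l G := by
  induction l generalizing y F G with
  | nil => rfl
  | cons n l ih =>
    simp only [westRow]
    rw [← ih]
    congr! 3 with s h
    split_ifs <;> ring

theorem westRow_mul (x : R) (y : ℕ → R) (l : List (WithTop ι)) (c : R)
    (F : List (WithTop ι) → WithTop ι → R) :
    westRow x y l (fun s h => c * F s h) = c * westRow x y l F := by
  induction l generalizing y F with
  | nil => rfl
  | cons n l ih =>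
    simp only [westRow]
    rw [← ih]
    congr! 3 with s h
    split_ifs <;> ring

theorem westRow_congr (x : R) (y : ℕ → R) (l : List (WithTop ι))
    {F G : List (WithTop ι) → WithTop ι → R} (hFG : ∀ s h, s.length = l.length → F s h = G s h) :
    westRow x y l F = westRow x y l G := by
  induction l generalizing y F G with
  | nil => exact hFG [] ⊤ rfl
  | cons n l ih =>
    simp only [westRow]
    refine ih _ fun s h hs => ?_
    rw [hFG (h :: s) n (by simp [hs]), hFG (n :: s) h (by simp [hs])]

theorem eastRow_add (x : R) (y : ℕ → R) (l : List (WithTop ι)) (h : WithTop ι)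
    (F G : List (WithTop ι) → WithTop ι → R) :
    eastRow x y l h (fun s h => F s h + G s h) = eastRow x y l h F + eastRow x y l h G := by
  induction l generalizing y F G h with
  | nil => rfl
  | cons n l ih =>
    simp only [eastRow, ih]
    split_ifs <;> ring

theorem eastRow_mul (x : R) (y : ℕ → R) (l : List (WithTop ι)) (h : WithTop ι) (c : R)
    (F : List (WithTop ι) → WithTop ι → R) :
    eastRow x y l h (fun s h => c * F s h) = c * eastRow x y l h F := by
  induction l generalizing y F h with
  | nil => rfl
  | cons n l ih =>
    simp only [eastRow, ih]
    split_ifs <;> ring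

theorem eastRow_congr (x : R) (y : ℕ → R) (l : List (WithTop ι)) (h : WithTop ι)
    {F G : List (WithTop ι) → WithTop ι → R} (hFG : ∀ s h, s.length = l.length → F s h = G s h) :
    eastRow x y l h F = eastRow x y l h G := by
  induction l generalizing y F G h with
  | nil => exact hFG [] h rfl
  | cons n l ih =>
    have tail_eq : ∀ a e, eastRow x (fun k => y (k + 1)) l e (fun s => F (a :: s)) =
        eastRow x (fun k => y (k + 1)) l e (fun s => G (a :: s)) := fun a e =>
      ih _ _ fun s h hs => hFG _ _ (by simp [hs])
    simp only [eastRow, tail_eq]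

theorem rowSum_add (b : RowType) (x : R) (y : ℕ → R) (l : List (WithTop ι))
    (F G : List (WithTop ι) → WithTop ι → R) :
    rowSum b x y l (fun s h => F s h + G s h) = rowSum b x y l F + rowSum b x y l G := by
  cases b
  · exact westRow_add x y l F G
  · exact eastRow_add x y l ⊤ F G

theorem rowSum_mul (b : RowType) (x : R) (y : ℕ → R) (l : List (WithTop ι)) (c : R)
    (F : List (WithTop ι) → WithTop ι → R) :
    rowSum b x y l (fun s h => c * F s h) = c * rowSum b x y l F := by
  cases b
  · exact westRow_mul x y l c F
  · exact eastRow_mul x y l ⊤ c F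

theorem rowSum_zero (b : RowType) (x : R) (y : ℕ → R) (l : List (WithTop ι)) :
    rowSum b x y l (fun _ _ => 0) = 0 := by
  simpa using rowSum_mul b x y l 0 (fun _ _ => 0)

theorem rowSum_congr (b : RowType) (x : R) (y : ℕ → R) (l : List (WithTop ι))
    {F G : List (WithTop ι) → WithTop ι → R} (hFG : ∀ s h, s.length = l.length → F s h = G s h) :
    rowSum b x y l F = rowSum b x y l G := by
  cases b
  · exact westRow_congr x y l hFG
  · exact eastRow_congr x y l ⊤ hFG

section Map

variable {S : Type*} [CommRing S] (φ : R →+* S)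

theorem map_westRow (x : R) (y : ℕ → R) (l : List (WithTop ι))
    (F : List (WithTop ι) → WithTop ι → R) :
    φ (westRow x y l F) = westRow (φ x) (φ ∘ y) l (fun s h => φ (F s h)) := by
  induction l generalizing y F with
  | nil => rfl
  | cons n l ih =>
    simp only [westRow, ih, Function.comp_def, map_add, apply_ite φ, map_mul, map_sub, map_zero]

theorem map_eastRow (x : R) (y : ℕ → R) (l : List (WithTop ι)) (h : WithTop ι)
    (F : List (WithTop ι) → WithTop ι → R) :
    φ (eastRow x y l h F) = eastRow (φ x) (φ ∘ y) l h (fun s h => φ (F s h)) := by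
  induction l generalizing y F h with
  | nil => rfl
  | cons n l ih =>
    simp only [eastRow, apply_ite φ, map_add, map_mul, map_sub, map_zero, ih, Function.comp_def]

theorem map_rowSum (b : RowType) (x : R) (y : ℕ → R) (l : List (WithTop ι))
    (F : List (WithTop ι) → WithTop ι → R) :
    φ (rowSum b x y l F) = rowSum b (φ x) (φ ∘ y) l (fun s h => φ (F s h)) := by
  cases b
  · exact map_westRow φ x y l F
  · exact map_eastRow φ x y l ⊤ F

theorem map_partitionFn (x : ι → R) (y : ℕ → R) (rows : List (RowType × ι))
    (l : List (WithTop ι)) :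
    φ (partitionFn x y rows l) = partitionFn (φ ∘ x) (φ ∘ y) rows l := by
  induction rows generalizing l with
  | nil => simp only [partitionFn, apply_ite φ, map_one, map_zero]
  | cons r rows ih =>
    simp only [partitionFn, map_rowSum, apply_ite φ, map_zero, ih, Function.comp_apply]

end Map

/-! ### Exchange of two adjacent column variables -/

/-- The operator on functions of a state that adds `c` times the value at the state with the
entries `j` and `j + 1` exchanged, if these form a descent. -/
def descentOp (c : R) : ℕ → (List (WithTop ι) → R) → List (WithTop ι) → R
  | 0, f, a :: b :: l => f (a :: b :: l) + if b < a then c * f (b :: a :: l) else 0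
  | j + 1, f, a :: l => descentOp c j (fun s => f (a :: s)) l
  | _, f, l => f l

theorem descentOp_add (c : R) (j : ℕ) (f g : List (WithTop ι) → R) (l : List (WithTop ι)) :
    descentOp c j (fun s => f s + g s) l = descentOp c j f l + descentOp c j g l := by
  induction j generalizing f g l with
  | zero =>
    rcases l with _ | ⟨a, _ | ⟨b, l⟩⟩ <;> simp only [descentOp]
    split_ifs <;> ring
  | succ j ih =>
    rcases l with _ | ⟨a, l⟩ <;> simp only [descentOp]
    exact ih _ _ _

theorem descentOp_mul (c d : R) (j : ℕ) (f : List (WithTop ι) → R) (l : List (WithTop ι)) :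
    descentOp c j (fun s => d * f s) l = d * descentOp c j f l := by
  induction j generalizing f l with
  | zero =>
    rcases l with _ | ⟨a, _ | ⟨b, l⟩⟩ <;> simp only [descentOp]
    split_ifs <;> ring
  | succ j ih =>
    rcases l with _ | ⟨a, l⟩ <;> simp only [descentOp]
    exact ih _ _

theorem descentOp_ite (c : R) (p : Prop) [Decidable p] (j : ℕ) (f : List (WithTop ι) → R)
    (l : List (WithTop ι)) :
    descentOp c j (fun s => if p then f s else 0) l = if p then descentOp c j f l else 0 := by
  by_cases hp : p
  · simp [hp]
  · simpa [hp] using descentOp_mul c 0 j f l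

theorem descentOp_allTop (c : R) (j : ℕ) (l : List (WithTop ι)) :
    descentOp c j (fun l => if ∀ a ∈ l, a = ⊤ then 1 else 0) l =
      if ∀ a ∈ l, a = ⊤ then 1 else 0 := by
  induction j generalizing l with
  | zero =>
    rcases l with _ | ⟨a, _ | ⟨b, l⟩⟩ <;> simp only [descentOp]
    by_cases hba : b < a
    · simp [hba.ne_top]
    · simp [hba]
  | succ j ih =>
    rcases l with _ | ⟨a, l⟩ <;> simp only [descentOp]
    by_cases ha : a = ⊤
    · simpa [ha] using ih l
    · simpa [ha] using descentOp_mul c 0 j (fun _ => (0 : R)) l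

theorem descentOp_ofFn (c : R) {n : ℕ} (j : ℕ) (hj : j + 1 < n) (f : List (WithTop ι) → R)
    (g : Fin n → WithTop ι) :
    descentOp c j f (List.ofFn g) = f (List.ofFn g) +
      if g ⟨j + 1, hj⟩ < g ⟨j, by omega⟩ then
        c * f (List.ofFn (g ∘ Equiv.swap ⟨j, by omega⟩ ⟨j + 1, hj⟩)) else 0 := by
  induction j generalizing n f with
  | zero =>
    obtain ⟨n, rfl⟩ : ∃ k, n = k + 2 := ⟨n - 2, by omega⟩
    simp only [List.ofFn_succ, descentOp]
    congr 3
  | succ j ih =>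
    obtain ⟨n, rfl⟩ : ∃ k, n = k + 1 := ⟨n - 1, by omega⟩
    have swap_zero : Equiv.swap (⟨j + 1, by omega⟩ : Fin (n + 1)) ⟨j + 1 + 1, hj⟩ 0 = 0 :=
      Equiv.swap_apply_of_ne_of_ne (by simp [Fin.ext_iff]) (by simp [Fin.ext_iff])
    have swap_succ : ∀ k : Fin n, Equiv.swap (⟨j + 1, by omega⟩ : Fin (n + 1)) ⟨j + 1 + 1, hj⟩
        k.succ = (Equiv.swap ⟨j, by omega⟩ ⟨j + 1, by omega⟩ k).succ := fun k =>
      ((Fin.succ_injective n).swap_apply ⟨j, by omega⟩ ⟨j + 1, by omega⟩ k)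
    simp only [List.ofFn_succ, descentOp, ih (by omega : j + 1 < n), Function.comp_def, swap_zero,
      swap_succ, Fin.succ_mk]

/-- The sequence `y` with the terms `j` and `j + 1` exchanged. -/
def swapSeq {α : Type*} (y : ℕ → α) (j : ℕ) : ℕ → α := fun k => y (Equiv.swap j (j + 1) k)

theorem swapSeq_zero_zero {α : Type*} (y : ℕ → α) : swapSeq y 0 0 = y 1 := by simp [swapSeq]

theorem swapSeq_zero_one {α : Type*} (y : ℕ → α) : swapSeq y 0 (0 + 1) = y 0 := by simp [swapSeq]

theorem swapSeq_zero_add_two {α : Type*} (y : ℕ → α) (k : ℕ) :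
    swapSeq y 0 (k + 1 + 1) = y (k + 1 + 1) := by
  simp only [swapSeq]
  rw [Equiv.swap_apply_of_ne_of_ne (by omega) (by omega)]

theorem swapSeq_succ_zero {α : Type*} (y : ℕ → α) (j : ℕ) : swapSeq y (j + 1) 0 = y 0 := by
  simp only [swapSeq]
  rw [Equiv.swap_apply_of_ne_of_ne (by omega) (by omega)]

theorem swapSeq_succ_succ {α : Type*} (y : ℕ → α) (j k : ℕ) :
    swapSeq y (j + 1) (k + 1) = swapSeq (fun k => y (k + 1)) j k := by
  simp only [swapSeq]
  exact congrArg y ((add_left_injective 1).swap_apply j (j + 1) k)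

/- This and `eastRow_exchange_zero` are the Yang–Baxter equation: exchanging the variables of two
adjacent columns can be pushed through a row, past the tiles in these columns. -/
theorem westRow_exchange_zero (x : R) (y : ℕ → R) (n₁ n₂ : WithTop ι) (l : List (WithTop ι))
    (F : List (WithTop ι) → WithTop ι → R) :
    westRow x (swapSeq y 0) (n₁ :: n₂ :: l)
        (fun s h => descentOp (y 0 - y 1) 0 (fun s => F s h) s) =
      descentOp (y 0 - y 1) 0 (fun l => westRow x y l F) (n₁ :: n₂ :: l) := by
  have ite_eq : ∀ a : R, (if n₂ < n₁ then a else 0) = (if n₂ < n₁ then 1 else 0) * a := fun a => by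
    split_ifs <;> ring
  simp only [westRow, descentOp, swapSeq_zero_add_two, swapSeq_zero_zero, swapSeq_zero_one]
  rw [← westRow_mul, ite_eq, ← westRow_mul, ← westRow_add]
  congr! 3 with s h
  rcases lt_trichotomy n₁ n₂ with h1 | h1 | h1 <;>
  rcases lt_trichotomy h n₁ with h2 | h2 | h2 <;>
  rcases lt_trichotomy h n₂ with h3 | h3 | h3 <;>
  first
    | (exfalso; order)
    | (simp only [h1, h2, h3, h1.not_gt, h2.not_gt, h3.not_gt, lt_irrefl, if_true, if_false]
       ring)

theorem westRow_exchange (x : R) (j : ℕ) (y : ℕ → R) (l : List (WithTop ι))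
    (hl : j + 1 < l.length) (F : List (WithTop ι) → WithTop ι → R) :
    westRow x (swapSeq y j) l (fun s h => descentOp (y j - y (j + 1)) j (fun s => F s h) s) =
      descentOp (y j - y (j + 1)) j (fun l => westRow x y l F) l := by
  induction j generalizing y l F with
  | zero =>
    rcases l with _ | ⟨n₁, _ | ⟨n₂, l⟩⟩
    · simp at hl
    · simp at hl
    · exact westRow_exchange_zero x y n₁ n₂ l F
  | succ j ih =>
    rcases l with _ | ⟨n, l⟩
    · simp at hl
    · have hl' : j + 1 < l.length := by simpa using hl
      simp only [westRow, descentOp, swapSeq_succ_succ, swapSeq_succ_zero]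
      rw [← ih (fun k => y (k + 1)) l hl']
      simp only [descentOp_add, descentOp_ite, descentOp_mul]

theorem eastRow_exchange_zero (x : R) (y : ℕ → R) (n₁ n₂ : WithTop ι) (l : List (WithTop ι))
    (h : WithTop ι) (F : List (WithTop ι) → WithTop ι → R) :
    eastRow x (swapSeq y 0) (n₁ :: n₂ :: l) h
        (fun s h => descentOp (y 0 - y 1) 0 (fun s => F s h) s) =
      descentOp (y 0 - y 1) 0 (fun l => eastRow x y l h F) (n₁ :: n₂ :: l) := by
  have tail_eq : ∀ a b e, eastRow x (fun k => y (k + 1 + 1)) l e (fun s h =>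
      F (a :: b :: s) h + if b < a then (y 0 - y 1) * F (b :: a :: s) h else 0) =
      eastRow x (fun k => y (k + 1 + 1)) l e (fun s => F (a :: b :: s)) + if b < a then
      (y 0 - y 1) * eastRow x (fun k => y (k + 1 + 1)) l e (fun s => F (b :: a :: s))
      else 0 := by
    intro a b e
    split_ifs
    · rw [eastRow_add, eastRow_mul]
    · simp only [add_zero]
  simp only [eastRow, descentOp, swapSeq_zero_add_two, swapSeq_zero_zero, swapSeq_zero_one,
    tail_eq]
  generalize eastRow x (fun k => y (k + 1 + 1)) l = G
  induction n₁ using WithTop.recTopCoe <;> induction n₂ using WithTop.recTopCoe <;>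
    induction h using WithTop.recTopCoe <;>
    simp only [WithTop.coe_ne_top, WithTop.coe_lt_coe, WithTop.coe_lt_top, not_top_lt, if_true,
      if_false, and_true, and_false, or_true, or_false, false_or, add_zero, zero_add,
      lt_irrefl]
  all_goals first | ring1 | (split_ifs <;> first | ring1 | (exfalso; order))

theorem eastRow_exchange (x : R) (j : ℕ) (y : ℕ → R) (l : List (WithTop ι)) (h : WithTop ι)
    (hl : j + 1 < l.length) (F : List (WithTop ι) → WithTop ι → R) :
    eastRow x (swapSeq y j) l h (fun s h => descentOp (y j - y (j + 1)) j (fun s => F s h) s) =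
      descentOp (y j - y (j + 1)) j (fun l => eastRow x y l h F) l := by
  induction j generalizing y l F h with
  | zero =>
    rcases l with _ | ⟨n₁, _ | ⟨n₂, l⟩⟩
    · simp at hl
    · simp at hl
    · exact eastRow_exchange_zero x y n₁ n₂ l h F
  | succ j ih =>
    rcases l with _ | ⟨n, l⟩
    · simp at hl
    · have hl' : j + 1 < l.length := by simpa using hl
      have tail_eq := fun h F => ih (fun k => y (k + 1)) l h hl' F
      simp only [eastRow, descentOp, swapSeq_succ_succ, swapSeq_succ_zero]
      rw [tail_eq ⊤ (fun s h => F (⊤ :: s) h), tail_eq h (fun s h => F (n :: s) h),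
        tail_eq n (fun s h' => F (h :: s) h')]
      by_cases hc : h = ⊤ ∧ n = ⊤
      · simp only [if_pos hc, descentOp_mul]
      · simp only [if_neg hc, descentOp_add, descentOp_ite]

theorem rowSum_exchange (b : RowType) (x : R) (j : ℕ) (y : ℕ → R) (l : List (WithTop ι))
    (hl : j + 1 < l.length) (F : List (WithTop ι) → WithTop ι → R) :
    rowSum b x (swapSeq y j) l (fun s h => descentOp (y j - y (j + 1)) j (fun s => F s h) s) =
      descentOp (y j - y (j + 1)) j (fun l => rowSum b x y l F) l := by
  cases b
  · exact westRow_exchange x j y l hl F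
  · exact eastRow_exchange x j y l ⊤ hl F

theorem partitionFn_swapSeq (x : ι → R) (y : ℕ → R) (j : ℕ) (rows : List (RowType × ι))
    (l : List (WithTop ι)) (hl : j + 1 < l.length) :
    partitionFn x (swapSeq y j) rows l =
      descentOp (y j - y (j + 1)) j (partitionFn x y rows) l := by
  induction rows generalizing l with
  | nil => exact (descentOp_allTop _ _ _).symm
  | cons r rows ih =>
    obtain ⟨b, a⟩ := r
    refine Eq.trans (rowSum_congr b _ _ l fun s h hs => ?_) (rowSum_exchange b (x a) j y l hl _)
    rw [ih s (by omega), descentOp_ite]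

end Lattice

/-! ### Rows with a forced filling -/

section ForcedRows

variable {R : Type*} [CommRing R] {ι : Type*} [LinearOrder ι]

theorem westRow_replicate_top (x : R) (y : ℕ → R) (q : ℕ)
    (F : List (WithTop ι) → WithTop ι → R) :
    westRow x y (List.replicate q ⊤) F = F (List.replicate q ⊤) ⊤ := by
  induction q generalizing y F with
  | zero => rfl
  | succ q ih => simp [List.replicate_succ, westRow, ih]

theorem westRow_append (x : R) (y : ℕ → R) (a : ι) (p l : List (WithTop ι))
    (F : List (WithTop ι) → WithTop ι → R) (hp : ∀ n ∈ p, a < n)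
    (hF : ∀ s (h : WithTop ι), h ≠ a → F s h = 0) :
    westRow x y (p ++ l) F = (∏ j ∈ range p.length, (x - y j)) *
      westRow x (fun k => y (k + p.length)) l (fun s => F (p ++ s)) := by
  induction p generalizing y F with
  | nil => simp
  | cons n p ih =>
    simp only [List.mem_cons, forall_eq_or_imp] at hp
    have forced : (fun s h => F (h :: s) n + if h < n then (x - y 0) * F (n :: s) h else 0) =
        fun s h => (x - y 0) * F (n :: s) h := by
      funext s h
      rw [hF _ n hp.1.ne', zero_add]
      split_ifs with hlt
      · rfl
      · rw [hF _ h (by rintro rfl; exact hlt hp.1), mul_zero]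
    simp only [List.cons_append, westRow, forced, westRow_mul, List.length_cons, prod_range_succ']
    rw [ih _ _ hp.2 fun s h' => hF _ _]
    simp only [add_assoc]
    ring

theorem eastRow_eq_zero (x : R) (y : ℕ → R) (b : ι) (l : List (WithTop ι)) (h : WithTop ι)
    (F : List (WithTop ι) → WithTop ι → R) (hb : (b : WithTop ι) ∉ l) (hh : h ≠ b)
    (hF : ∀ s (h : WithTop ι), h ≠ b → F s h = 0) : eastRow x y l h F = 0 := by
  induction l generalizing y F h with
  | nil => exact hF _ _ hh
  | cons n l ih =>
    simp only [List.mem_cons, not_or] at hb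
    have tail_eq_zero : ∀ a e, e ≠ (b : WithTop ι) →
        eastRow x (fun k => y (k + 1)) l e (fun s => F (a :: s)) = 0 :=
      fun a e he => ih _ _ _ hb.2 he fun s h' => hF _ _
    simp only [eastRow, tail_eq_zero _ h hh, tail_eq_zero _ n (Ne.symm hb.1),
      tail_eq_zero _ ⊤ WithTop.top_ne_coe, mul_zero, ite_self, add_zero]

theorem eastRow_append_eq_zero (x : R) (y : ℕ → R) (b : ι) (p l : List (WithTop ι))
    (h : WithTop ι) (F : List (WithTop ι) → WithTop ι → R) (hp : ∀ n ∈ p, n ≠ ⊤)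
    (hl : (b : WithTop ι) ∉ l) (hh : h ≠ b) (hh' : h ≠ ⊤)
    (hF : ∀ s (h : WithTop ι), h ≠ b → F s h = 0) :
    eastRow x y (p ++ (b : WithTop ι) :: l) h F = 0 := by
  induction p generalizing y F with
  | nil =>
    simp only [List.nil_append, eastRow, hh', WithTop.coe_ne_top, false_and, or_false, if_false,
      add_zero, eastRow_eq_zero x _ b l h _ hl hh fun _ _ => hF _ _, ite_self]
  | cons n p ih =>
    simp only [List.mem_cons, forall_eq_or_imp] at hp
    simp only [List.cons_append, eastRow, hh', hp.1, false_and, or_false, if_false, add_zero,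
      ih _ (fun s => F (n :: s)) hp.2 fun _ _ => hF _ _, ite_self]

theorem eastRow_of_max (x : R) (y : ℕ → R) (b : ι) (l : List (WithTop ι))
    (F : List (WithTop ι) → WithTop ι → R) (hl : ∀ n ∈ l, n < b ∨ n = ⊤)
    (hF : ∀ s (h : WithTop ι), h ≠ b → F s h = 0) : eastRow x y l b F = F l b := by
  induction l generalizing y F with
  | nil => rfl
  | cons n l ih =>
    simp only [List.mem_cons, forall_eq_or_imp] at hl
    have bump_eq_zero : eastRow x (fun k => y (k + 1)) l n (fun s => F (b :: s)) = 0 := by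
      refine eastRow_eq_zero _ _ b _ _ _ (fun hm => ?_) ?_ fun s h' => hF _ _
      · simpa using hl.2 _ hm
      · rintro rfl
        simp at hl
    simp only [eastRow, WithTop.coe_ne_top, false_and, if_false, if_pos hl.1.symm, bump_eq_zero,
      ite_self, add_zero]
    exact ih _ _ hl.2 fun s h' => hF _ _

theorem eastRow_append_of_max (x : R) (y : ℕ → R) (b : ι) (p l : List (WithTop ι))
    (F : List (WithTop ι) → WithTop ι → R) (hp : ∀ n ∈ p, n < b)
    (hl : ∀ n ∈ l, n < b ∨ n = ⊤) (hF : ∀ s (h : WithTop ι), h ≠ b → F s h = 0) :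
    eastRow x y (p ++ (b : WithTop ι) :: l) ⊤ F = F (p ++ ⊤ :: l) b := by
  have hbl : (b : WithTop ι) ∉ l := fun hm => by simpa using hl _ hm
  induction p generalizing y F with
  | nil =>
    have pass_eq_zero : eastRow x (fun k => y (k + 1)) l ⊤ (fun s => F (b :: s)) = 0 :=
      eastRow_eq_zero _ _ b _ _ _ hbl (by simp) fun s h' => hF _ _
    simp only [List.nil_append, eastRow, WithTop.coe_ne_top, and_false, if_false, true_or,
      if_true, pass_eq_zero, ite_self, zero_add]
    exact eastRow_of_max _ _ _ _ _ hl fun s h' => hF _ _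
  | cons n p ih =>
    simp only [List.mem_cons, forall_eq_or_imp] at hp
    have bump_eq_zero :
        eastRow x (fun k => y (k + 1)) (p ++ (b : WithTop ι) :: l) n (fun s => F (⊤ :: s)) = 0 :=
      eastRow_append_eq_zero _ _ b _ _ _ _ (fun a ha => (hp.2 a ha).ne_top) hbl hp.1.ne
        hp.1.ne_top fun s h' => hF _ _
    simp only [List.cons_append, eastRow, hp.1.ne_top, and_false, if_false, true_or, if_true,
      bump_eq_zero, add_zero, hp.1.ne_top.lt_top, or_true]
    exact ih _ _ hp.2 fun s h' => hF _ _

theorem eastRow_replicate_top_append (x : R) (y : ℕ → R) (p : ℕ) (l : List (WithTop ι))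
    (F : List (WithTop ι) → WithTop ι → R) :
    eastRow x y (List.replicate p ⊤ ++ l) ⊤ F = (∏ j ∈ range p, (x - y j)) *
      eastRow x (fun k => y (k + p)) l ⊤ (fun s => F (List.replicate p ⊤ ++ s)) := by
  induction p generalizing y F with
  | zero => simp
  | succ p ih =>
    simp only [List.replicate_succ, List.cons_append, eastRow, and_self, if_true, ih,
      prod_range_succ', add_assoc]
    ring

theorem partitionFn_west_append (x : ι → R) (y : ℕ → R) (a : ι) (rows : List (RowType × ι))
    (p : List (WithTop ι)) (hp : ∀ n ∈ p, a < n) (q : ℕ) :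
    partitionFn x y ((.west, a) :: rows) (p ++ (a : WithTop ι) :: List.replicate q ⊤) =
      (∏ j ∈ range p.length, (x a - y j)) *
        partitionFn x y rows (p ++ List.replicate (q + 1) ⊤) := by
  have vanish : ∀ s (h : WithTop ι), h ≠ a → (if h = a then partitionFn x y rows s else 0) = 0 :=
    fun s h hh => if_neg hh
  rw [partitionFn, rowSum, westRow_append _ _ a _ _ _ hp vanish]
  simp [westRow, westRow_replicate_top, List.replicate_succ]

theorem partitionFn_east_append (x : ι → R) (y : ℕ → R) (b : ι) (rows : List (RowType × ι))
    (p l : List (WithTop ι)) (hp : ∀ n ∈ p, n < b) (hl : ∀ n ∈ l, n < b ∨ n = ⊤) :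
    partitionFn x y ((.east, b) :: rows) (p ++ (b : WithTop ι) :: l) =
      partitionFn x y rows (p ++ ⊤ :: l) := by
  rw [partitionFn, rowSum, eastRow_append_of_max _ _ _ _ _ _ hp hl fun s h hh => if_neg hh,
    if_pos rfl]

theorem partitionFn_east_replicate_top (x : ι → R) (y : ℕ → R) (b : ι)
    (rows : List (RowType × ι)) (p : ℕ) (l : List (WithTop ι)) (hl : ∀ n ∈ l, n < b ∨ n = ⊤) :
    partitionFn x y ((.east, b) :: rows) (List.replicate p ⊤ ++ (b : WithTop ι) :: l) =
      (∏ j ∈ range p, (x b - y j)) * partitionFn x y rows (List.replicate (p + 1) ⊤ ++ l) := by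
  have first_column := eastRow_append_of_max (x b) (fun k => y (k + p)) b [] l
    (fun s h => if h = b then partitionFn x y rows (List.replicate p ⊤ ++ s) else 0) (by simp) hl
    fun s h hh => if_neg hh
  rw [List.nil_append] at first_column
  rw [partitionFn, rowSum, eastRow_replicate_top_append, first_column]
  simp [List.replicate_succ']

theorem partitionFn_east_set (x : ι → R) (y : ℕ → R) (b : ι) (rows : List (RowType × ι))
    (l : List (WithTop ι)) (c : ℕ) (hc : l[c]? = some (b : WithTop ι))
    (hlt : ∀ k (hk : k < l.length), k < c → l[k] < b)
    (hgt : ∀ k (hk : k < l.length), c < k → l[k] < b ∨ l[k] = ⊤) :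
    partitionFn x y ((.east, b) :: rows) l = partitionFn x y rows (l.set c ⊤) := by
  obtain ⟨hcl, hcb⟩ := List.getElem?_eq_some_iff.1 hc
  have split : l = l.take c ++ (b : WithTop ι) :: l.drop (c + 1) := by
    rw [← hcb, List.cons_getElem_drop_succ, List.take_append_drop]
  rw [List.set_eq_take_append_cons_drop, if_pos hcl]
  conv_lhs => rw [split]
  refine partitionFn_east_append x y b rows _ _ (fun n hn => ?_) fun n hn => ?_
  · obtain ⟨k, hk, rfl⟩ := List.mem_take_iff_getElem.1 hn
    exact hlt k (by omega) (by omega)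
  · obtain ⟨k, hk, rfl⟩ := List.mem_drop_iff_getElem.1 hn
    exact hgt _ _ (by omega)

end ForcedRows

/-! ### The value at the longest permutation -/

/-- The rows carry the labels `a, a + 1, …` in the order of the entries of their pipes. -/
def IsNumbered : ℕ → List (RowType × ℕ) → Prop
  | _, [] => True
  | a, (.west, b) :: rows => b = a ∧ IsNumbered (a + 1) rows
  | a, (.east, b) :: rows => b = a + rows.length ∧ IsNumbered a rows

/-- The state with the labels `a + m - 1, …, a`, in this order, in consecutive columns, with `p`
empty columns to the West and `q` empty columns to the East. -/
def descState (p a m q : ℕ) : List (WithTop ℕ) :=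
  List.replicate p ⊤ ++ ((List.range' a m).reverse.map WithTop.some ++ List.replicate q ⊤)

theorem partitionFn_west_descState {R : Type*} [CommRing R] (x y : ℕ → R) (p a m q : ℕ)
    (rows : List (RowType × ℕ)) :
    partitionFn x y ((.west, a) :: rows) (descState p a (m + 1) q) =
      (∏ j ∈ range (p + m), (x a - y j)) *
        partitionFn x y rows (descState p (a + 1) m (q + 1)) := by
  have h := partitionFn_west_append x y a rows
    (List.replicate p ⊤ ++ (List.range' (a + 1) m).reverse.map WithTop.some) (fun n hn => ?_) q
  · simpa [descState, List.range'_succ] using h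
  · simp only [List.mem_append, List.mem_replicate, List.mem_map, List.mem_reverse,
      List.mem_range'_1] at hn
    rcases hn with ⟨-, rfl⟩ | ⟨k, hk, rfl⟩
    · exact WithTop.coe_lt_top a
    · exact WithTop.coe_lt_coe.2 hk.1

theorem partitionFn_east_descState {R : Type*} [CommRing R] (x y : ℕ → R) (p a m q : ℕ)
    (rows : List (RowType × ℕ)) :
    partitionFn x y ((.east, a + m) :: rows) (descState p a (m + 1) q) =
      (∏ j ∈ range p, (x (a + m) - y j)) * partitionFn x y rows (descState (p + 1) a m q) := by
  have h := partitionFn_east_replicate_top x y (a + m) rows p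
    ((List.range' a m).reverse.map WithTop.some ++ List.replicate q ⊤) (fun n hn => ?_)
  · simpa [descState, List.range'_concat] using h
  · simp only [List.mem_append, List.mem_replicate, List.mem_map, List.mem_reverse,
      List.mem_range'_1] at hn
    rcases hn with ⟨k, hk, rfl⟩ | ⟨-, rfl⟩
    · exact Or.inl (WithTop.coe_lt_coe.2 hk.2)
    · exact Or.inr rfl

theorem partitionFn_descState {R : Type*} [CommRing R] (x y : ℕ → R)
    (rows : List (RowType × ℕ)) (p a q : ℕ) (hr : IsNumbered a rows) :
    partitionFn x y rows (descState p a rows.length q) =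
      ∏ k ∈ range rows.length, ∏ j ∈ range (p + (rows.length - 1 - k)), (x (a + k) - y j) := by
  induction rows generalizing p a q with
  | nil => simp [partitionFn, descState]
  | cons r rows ih =>
    rcases r with ⟨_ | _, b⟩
    · obtain ⟨rfl, hr⟩ := hr
      rw [List.length_cons, partitionFn_west_descState, ih p (b + 1) (q + 1) hr, prod_range_succ',
        mul_comm]
      congr 1
      refine prod_congr rfl fun k _ => ?_
      rw [add_right_comm b 1 k, add_assoc b k 1, Nat.add_sub_cancel, Nat.sub_sub, add_comm 1 k]
    · obtain ⟨rfl, hr⟩ := hr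
      rw [List.length_cons, partitionFn_east_descState, ih (p + 1) a q hr, prod_range_succ]
      have last : p + (rows.length + 1 - 1 - rows.length) = p := by omega
      rw [last, mul_comm]
      congr 1
      refine prod_congr rfl fun k hk => ?_
      have := mem_range.1 hk
      rw [show p + 1 + (rows.length - 1 - k) = p + (rows.length + 1 - 1 - k) by omega]

end HybridPipeDream

namespace DoubleSchubert

open MvPolynomial

variable {n : ℕ}

/-! ### Double Schubert polynomials and the exchange of the `y` variables -/

theorem eq_revPerm_of_no_ascent {w : Equiv.Perm (Fin n)} (h : ¬ ∃ p, IsAscent w p) :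
    w = Fin.revPerm := by
  have monotone_rev : Monotone ⇑((Fin.revPerm : Equiv.Perm (Fin n)) * w) := by
    rcases n with _ | n
    · exact fun a => a.elim0
    · refine Fin.monotone_iff_le_succ.2 fun i => ?_
      simp only [Equiv.Perm.mul_apply, Fin.revPerm_apply, Fin.rev_le_rev]
      exact not_lt.1 fun hlt => h ⟨(i.castSucc, i.succ), by simp, hlt⟩
  exact eq_inv_of_mul_eq_one_right (Equiv.Perm.monotone_iff _ |>.1 monotone_rev)

theorem revPerm_mul_swap (i j : Fin n) :
    Fin.revPerm * Equiv.swap i j = Equiv.swap (Fin.rev j) (Fin.rev i) * Fin.revPerm := by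
  rw [Equiv.swap_comm (Fin.rev j)]
  exact Equiv.mul_swap_eq_swap_mul _ _ _

theorem swap_lt_swap_iff {k k' : Fin n} (hk : k'.val = k.val + 1) {a b : Fin n}
    (h1 : ¬ (a = k ∧ b = k')) (h2 : ¬ (a = k' ∧ b = k)) :
    Equiv.swap k k' a < Equiv.swap k k' b ↔ a < b := by
  simp only [Equiv.swap_apply_def, Fin.ext_iff, Fin.lt_def] at *
  split_ifs <;> omega

theorem descent_iff_of_inv_ascent {w : Equiv.Perm (Fin n)} {i i' j j' : Fin n}
    (hi : i'.val = i.val + 1) (hj : j'.val = j.val + 1) (hlt : w⁻¹ j < w⁻¹ j') :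
    w i' < w i ↔ (Equiv.swap j j' * w) i' < (Equiv.swap j j' * w) i ∧
      Equiv.swap i i' (w⁻¹ j) < Equiv.swap i i' (w⁻¹ j') := by
  by_cases hs : w⁻¹ j = i ∧ w⁻¹ j' = i'
  · obtain ⟨rfl, rfl⟩ := hs
    refine iff_of_false ?_ fun h => ?_
    · have hjj' : ¬ w (w⁻¹ j') < w (w⁻¹ j) := by
        simp only [Equiv.Perm.coe_inv, Equiv.apply_symm_apply, Fin.lt_def]
        omega
      exact hjj'
    · rw [Equiv.swap_apply_left, Equiv.swap_apply_right] at h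
      exact h.2.not_gt hlt
  · have hs' : ¬ (w⁻¹ j = i' ∧ w⁻¹ j' = i) := by
      rintro ⟨h1, h2⟩
      rw [h1, h2, Fin.lt_def] at hlt
      omega
    rw [swap_lt_swap_iff hi hs hs', and_iff_left hlt, Equiv.Perm.mul_apply,
      Equiv.Perm.mul_apply, swap_lt_swap_iff hj]
    · rintro ⟨h1, h2⟩
      exact hs' ⟨by simp [← h1], by simp [← h2]⟩
    · rintro ⟨h1, h2⟩
      exact hs ⟨by simp [← h2], by simp [← h1]⟩

/-- Exchange of the variables `y i` and `y j`. -/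
noncomputable def swapY (i j : Fin n) :
    MvPolynomial (Fin n ⊕ Fin n) ℤ →ₐ[ℤ] MvPolynomial (Fin n ⊕ Fin n) ℤ :=
  rename (Sum.map id (Equiv.swap i j))

theorem swapX_swapY_comm (i i' j j' : Fin n) (f : MvPolynomial (Fin n ⊕ Fin n) ℤ) :
    swapX i i' (swapY j j' f) = swapY j j' (swapX i i' f) := by
  simp only [swapX, swapY, rename_rename, Sum.map_comp_map, Function.id_comp, Function.comp_id]

theorem swapY_X_inl (j j' i : Fin n) : swapY j j' (X (Sum.inl i)) = X (Sum.inl i) := by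
  simp [swapY]

theorem swapY_X_inr (j j' k : Fin n) :
    swapY j j' (X (Sum.inr k)) = X (Sum.inr (Equiv.swap j j' k)) := by
  simp [swapY]

theorem X_sub_X_ne_zero {i j : Fin n ⊕ Fin n} (h : i ≠ j) :
    (X i - X j : MvPolynomial (Fin n ⊕ Fin n) ℤ) ≠ 0 :=
  sub_ne_zero.2 fun he => h (X_injective he)

/-- The double Schubert polynomial of the longest permutation. -/
noncomputable def longestProd (n : ℕ) : MvPolynomial (Fin n ⊕ Fin n) ℤ :=
  ∏ p ∈ (univ : Finset (Fin n × Fin n)).filter (fun p => p.1.val + p.2.val + 2 ≤ n),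
    (X (Sum.inl p.1) - X (Sum.inr p.2))

theorem exists_longestProd_eq_mul {i i' j j' : Fin n} (hi : i'.val = i.val + 1)
    (hj : j'.val = j.val + 1) (hij : i.val + j.val + 2 = n) :
    ∃ G, longestProd n = (X (Sum.inl i) - X (Sum.inr j)) * G ∧ swapX i i' G = G ∧
      swapY j j' G = G := by
  have hm : (i, j) ∈ (univ : Finset (Fin n × Fin n)).filter
      (fun p => p.1.val + p.2.val + 2 ≤ n) := by
    rw [mem_filter]
    exact ⟨mem_univ _, hij.le⟩
  refine ⟨_, (mul_prod_erase _ _ hm).symm, ?_, ?_⟩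
  · simp only [swapX, map_prod, map_sub, rename_X, Sum.map_inl, Sum.map_inr, id]
    refine prod_equiv ((Equiv.swap i i').prodCongr (Equiv.refl _)) ?_ fun _ _ => rfl
    rintro ⟨a, b⟩
    simp only [mem_erase, mem_filter, mem_univ, true_and, Equiv.prodCongr_apply, Prod.map,
      Equiv.refl_apply, Equiv.swap_apply_def, Prod.mk.injEq, ne_eq, Fin.ext_iff]
    split_ifs <;> omega
  · simp only [map_prod, map_sub, swapY_X_inl, swapY_X_inr]
    refine prod_equiv ((Equiv.refl _).prodCongr (Equiv.swap j j')) ?_ fun _ _ => rfl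
    rintro ⟨a, b⟩
    simp only [mem_erase, mem_filter, mem_univ, true_and, Equiv.prodCongr_apply, Prod.map,
      Equiv.refl_apply, Equiv.swap_apply_def, Prod.mk.injEq, ne_eq, Fin.ext_iff]
    split_ifs <;> omega

/-- The exchange relations in the `y` variables, which hold for the double Schubert polynomials. -/
def YExchange (F : Equiv.Perm (Fin n) → MvPolynomial (Fin n ⊕ Fin n) ℤ) : Prop :=
  ∀ (w : Equiv.Perm (Fin n)) (j j' : Fin n), j'.val = j.val + 1 → swapY j j' (F w) = F w +
    if w⁻¹ j' < w⁻¹ j then (X (Sum.inr j) - X (Sum.inr j')) * F (Equiv.swap j j' * w) else 0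

/-- The exchange relations in the `x` variables at the permutation `w`; for the double Schubert
polynomials these are the divided difference recursion. -/
def XExchangeAt (F : Equiv.Perm (Fin n) → MvPolynomial (Fin n ⊕ Fin n) ℤ)
    (w : Equiv.Perm (Fin n)) : Prop :=
  ∀ i i' : Fin n, i'.val = i.val + 1 → F w - swapX i i' (F w) =
    if w i' < w i then (X (Sum.inl i) - X (Sum.inl i')) * F (w * Equiv.swap i i') else 0

section Exchange

variable {F : Equiv.Perm (Fin n) → MvPolynomial (Fin n ⊕ Fin n) ℤ}

theorem YExchange.mul_eq (hy : YExchange F) {w : Equiv.Perm (Fin n)} {j j' : Fin n}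
    (hj : j'.val = j.val + 1) (hlt : w⁻¹ j < w⁻¹ j') :
    (X (Sum.inr j) - X (Sum.inr j')) * F w =
      swapY j j' (F (Equiv.swap j j' * w)) - F (Equiv.swap j j' * w) := by
  rw [hy _ j j' hj, if_pos (by simpa using hlt), Equiv.swap_mul_self_mul, add_sub_cancel_left]

theorem YExchange.xExchangeAt_revPerm (hy : YExchange F)
    (hrev : F Fin.revPerm = longestProd n) : XExchangeAt F Fin.revPerm := by
  intro i i' hi
  have hii' : i < i' := Fin.lt_def.2 (by omega)
  have hj : (Fin.rev i).val = (Fin.rev i').val + 1 := by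
    simp only [Fin.val_rev]
    omega
  have hlt : (Fin.revPerm * Equiv.swap i i' : Equiv.Perm (Fin n))⁻¹ (Fin.rev i') <
      (Fin.revPerm * Equiv.swap i i' : Equiv.Perm (Fin n))⁻¹ (Fin.rev i) := by
    simpa using hii'
  have y_descent := hy.mul_eq hj hlt
  rw [revPerm_mul_swap, Equiv.swap_mul_self_mul, ← revPerm_mul_swap, hrev] at y_descent
  obtain ⟨G, hG, hGX, hGY⟩ := exists_longestProd_eq_mul hi hj (by simp only [Fin.val_rev]; omega)
  rw [if_pos (by simpa using hii'), hrev]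
  refine mul_left_cancel₀ (X_sub_X_ne_zero fun h => ?_) (?_ :
    (X (Sum.inr (Fin.rev i')) - X (Sum.inr (Fin.rev i))) * _ = _)
  · exact hii'.ne' (Fin.rev_injective (Sum.inr_injective h))
  have swapX_eq : swapX i i' (longestProd n) =
      (X (Sum.inl i') - X (Sum.inr (Fin.rev i'))) * G := by
    rw [hG]
    conv_rhs => rw [← hGX]
    simp [swapX]
  rw [mul_left_comm, y_descent, swapX_eq, hG, map_mul, hGY, map_sub, swapY_X_inl, swapY_X_inr,
    Equiv.swap_apply_left]
  ring

/- Exchanges of `y` variables multiply `w` on the left, divided differences on the right, and the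
two commute; so the relations in `x` propagate from the longest permutation along the weak order. -/
theorem YExchange.xExchangeAt_of_swap_mul (hy : YExchange F) {w : Equiv.Perm (Fin n)}
    {j j' : Fin n} (hj : j'.val = j.val + 1) (hlt : w⁻¹ j < w⁻¹ j')
    (hx : XExchangeAt F (Equiv.swap j j' * w)) : XExchangeAt F w := by
  intro i i' hi
  have hxi := hx i i' hi
  have hyi := hy (Equiv.swap j j' * (w * Equiv.swap i i')) j j' hj
  rw [Equiv.swap_mul_self_mul, ← mul_assoc] at hyi
  simp only [mul_inv_rev, Equiv.swap_inv, Equiv.Perm.mul_apply, Equiv.swap_apply_left,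
    Equiv.swap_apply_right] at hyi
  refine mul_left_cancel₀ (X_sub_X_ne_zero fun h => ?_) (?_ :
    (X (Sum.inr j) - X (Sum.inr j')) * _ = _)
  · exact hlt.ne (congrArg _ (Sum.inr_injective h))
  have commute : (X (Sum.inr j) - X (Sum.inr j')) * (F w - swapX i i' (F w)) =
      swapY j j' (F (Equiv.swap j j' * w) - swapX i i' (F (Equiv.swap j j' * w))) -
        (F (Equiv.swap j j' * w) - swapX i i' (F (Equiv.swap j j' * w))) := by
    have swapX_mul_eq : (X (Sum.inr j) - X (Sum.inr j')) * swapX i i' (F w) =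
        swapX i i' ((X (Sum.inr j) - X (Sum.inr j')) * F w) := by simp [swapX]
    have swapX_sub : ∀ f g, swapX i i' (f - g) = swapX i i' f - swapX i i' g := map_sub _
    rw [mul_sub, swapX_mul_eq, hy.mul_eq hj hlt, map_sub, ← swapX_swapY_comm, swapX_sub]
    ring
  rw [commute, hxi]
  simp only [descent_iff_of_inv_ascent hi hj hlt]
  by_cases h1 : (Equiv.swap j j' * w) i' < (Equiv.swap j j' * w) i
  · rw [if_pos h1, map_mul, map_sub, swapY_X_inl, swapY_X_inl, hyi]
    by_cases h2 : Equiv.swap i i' (w⁻¹ j) < Equiv.swap i i' (w⁻¹ j')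
    · rw [if_pos h2, if_pos ⟨h1, h2⟩]
      ring
    · rw [if_neg h2, if_neg fun h => h2 h.2]
      ring
  · rw [if_neg h1, if_neg fun h => h1 h.1, map_zero, sub_zero, mul_zero]

theorem YExchange.xExchangeAt (hy : YExchange F) (hrev : F Fin.revPerm = longestProd n)
    (w : Equiv.Perm (Fin n)) : XExchangeAt F w := by
  induction hμ : ∑ a, a.val * (w⁻¹ a).val using Nat.strong_induction_on generalizing w with
  | _ μ ih =>
  by_cases hw : ∃ p, IsAscent w⁻¹ p
  · obtain ⟨⟨j, j'⟩, hasc⟩ := hw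
    have hm := hasc.measure_lt
    refine hy.xExchangeAt_of_swap_mul hasc.1 hasc.2 (ih _ ?_ _ rfl)
    rwa [mul_inv_rev, Equiv.swap_inv, ← hμ]
  · rw [← inv_inv w, eq_revPerm_of_no_ascent hw]
    exact hy.xExchangeAt_revPerm hrev

theorem doubleSchubert_eq_of_yExchange (hy : YExchange F) (hrev : F Fin.revPerm = longestProd n)
    (w : Equiv.Perm (Fin n)) : doubleSchubert w = F w := by
  induction hμ : ∑ a, a.val * (w a).val using Nat.strong_induction_on generalizing w with
  | _ μ ih =>
  rw [doubleSchubert]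
  split_ifs with h
  · have hasc := h.choose_spec
    set p := h.choose
    rw [ih _ (hμ ▸ hasc.measure_lt) _ rfl]
    refine mul_left_cancel₀ (X_sub_X_ne_zero fun h => ?_) (?_ :
      (X (Sum.inl p.1) - X (Sum.inl p.2)) * _ = _)
    · exact hasc.2.ne (congrArg _ (Sum.inl_injective h))
    rw [dividedDifference, ← (sub_dvd_sub_swapX p.1 p.2 (F (w * Equiv.swap p.1 p.2))).choose_spec,
      hy.xExchangeAt hrev _ _ _ hasc.1, mul_assoc, Equiv.swap_mul_self, mul_one, if_pos]
    simpa using hasc.2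
  · rw [eq_revPerm_of_no_ascent h, hrev, longestProd]

end Exchange

end DoubleSchubert

namespace HybridPipeDream

/-! ### Completion by rows of type `east` -/

/-- The state in which the pipes numbered `0, …, k - 1` stand in the columns given by the one-line
notation of `w`, and the other columns are empty. -/
def permState {n : ℕ} (w : Equiv.Perm (Fin n)) (k : ℕ) (c : Fin n) : WithTop ℕ :=
  if (w⁻¹ c).val < k then WithTop.some (w⁻¹ c).val else ⊤

theorem permState_apply {n : ℕ} (w : Equiv.Perm (Fin n)) (k : ℕ) (b : Fin n) :
    permState w k (w b) = if b.val < k then WithTop.some b.val else ⊤ := by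
  simp [permState]

theorem ofFn_permState_eq_set {n : ℕ} (w : Equiv.Perm (Fin n)) (b : Fin n) :
    List.ofFn (permState w b) = (List.ofFn (permState w (b + 1))).set (w b) ⊤ := by
  refine List.ext_getElem (by simp) fun k hk hk' => ?_
  obtain ⟨a, ha⟩ := w.surjective ⟨k, by simpa using hk⟩
  have hkb : (w b).val = k ↔ b = a := by
    rw [← w.injective.eq_iff, ha, Fin.ext_iff]
  simp only [List.getElem_set, List.getElem_ofFn, hkb, ← ha, permState_apply, Fin.ext_iff]
  split_ifs <;> first | rfl | omega

/-- Rows of type `east` with labels `m + d - 1, …, m` on top of the given rows. -/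
def addEastRows (m : ℕ) (rows : List (RowType × ℕ)) : ℕ → List (RowType × ℕ)
  | 0 => rows
  | d + 1 => (.east, m + d) :: addEastRows m rows d

theorem length_addEastRows (rows : List (RowType × ℕ)) (d : ℕ) :
    (addEastRows rows.length rows d).length = rows.length + d := by
  induction d with
  | zero => rfl
  | succ d ih => simp [addEastRows, ih, add_assoc]

theorem isNumbered_addEastRows {rows : List (RowType × ℕ)} (h : IsNumbered 0 rows) (d : ℕ) :
    IsNumbered 0 (addEastRows rows.length rows d) := by
  induction d with
  | zero => exact h
  | succ d ih => exact ⟨by rw [length_addEastRows, zero_add], ih⟩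

section AddEastRows

variable {R : Type*} [CommRing R]

theorem partitionFn_east_permState (x y : ℕ → R) {n : ℕ} (w : Equiv.Perm (Fin n)) (b : Fin n)
    (hw : ∀ a, b < a → w b < w a) (rows : List (RowType × ℕ)) :
    partitionFn x y ((.east, b.val) :: rows) (List.ofFn (permState w (b + 1))) =
      partitionFn x y rows (List.ofFn (permState w b)) := by
  have label_eq : ∀ k (hk : k < (List.ofFn (permState w (b + 1))).length), ∃ a : Fin n,
      (w a).val = k ∧ (List.ofFn (permState w (b + 1)))[k] =
        if a.val < b + 1 then WithTop.some a.val else ⊤ := by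
    intro k hk
    obtain ⟨a, ha⟩ := w.surjective ⟨k, by simpa using hk⟩
    refine ⟨a, congrArg Fin.val ha, ?_⟩
    rw [List.getElem_ofFn, ← permState_apply, ha]
  rw [ofFn_permState_eq_set]
  refine partitionFn_east_set x y b.val rows _ (w b) ?_ (fun k hk hkb => ?_) fun k hk hkb => ?_
  · simp [permState]
  · obtain ⟨a, rfl, ha⟩ := label_eq k hk
    have hab : a < b := lt_of_le_of_ne (not_lt.1 fun h => (hw a h).not_gt hkb) fun h =>
      hkb.ne (by rw [h])
    rw [ha, if_pos (Nat.lt_succ_of_lt hab)]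
    exact WithTop.coe_lt_coe.2 hab
  · obtain ⟨a, rfl, ha⟩ := label_eq k hk
    rw [ha]
    split_ifs with hab
    · have hne : a.val ≠ b.val := fun h => hkb.ne (by rw [Fin.ext h])
      exact Or.inl (WithTop.coe_lt_coe.2 (by omega))
    · exact Or.inr rfl

theorem partitionFn_addEastRows (x y : ℕ → R) {n : ℕ} (w : Equiv.Perm (Fin n))
    (rows : List (RowType × ℕ)) (hw : ∀ a b : Fin n, rows.length ≤ a.val → a < b → w a < w b)
    (d : ℕ) (hd : rows.length + d ≤ n) :
    partitionFn x y (addEastRows rows.length rows d)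
        (List.ofFn (permState w (rows.length + d))) =
      partitionFn x y rows (List.ofFn (permState w rows.length)) := by
  induction d with
  | zero => rfl
  | succ d ih =>
    rw [← ih (by omega)]
    exact partitionFn_east_permState x y w ⟨rows.length + d, by omega⟩
      (fun a ha => hw _ a (by simp) ha) _

end AddEastRows

/-! ### The partition function as a double Schubert polynomial -/

open MvPolynomial DoubleSchubert

/-- The variables `x`, as a sequence that continues with zeros. -/
noncomputable def xSeq (n k : ℕ) : MvPolynomial (Fin n ⊕ Fin n) ℤ :=
  if h : k < n then X (Sum.inl ⟨k, h⟩) else 0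

/-- The variables `y`, as a sequence that continues with zeros. -/
noncomputable def ySeq (n k : ℕ) : MvPolynomial (Fin n ⊕ Fin n) ℤ :=
  if h : k < n then X (Sum.inr ⟨k, h⟩) else 0

theorem xSeq_val {n : ℕ} (i : Fin n) : xSeq n i = X (Sum.inl i) := dif_pos i.isLt

theorem ySeq_val {n : ℕ} (j : Fin n) : ySeq n j = X (Sum.inr j) := dif_pos j.isLt

theorem swapY_xSeq {n : ℕ} (j j' : Fin n) (k : ℕ) : swapY j j' (xSeq n k) = xSeq n k := by
  rw [xSeq]
  split_ifs
  · exact swapY_X_inl _ _ _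
  · exact map_zero _

theorem swapY_ySeq {n : ℕ} {j j' : Fin n} (hj : j'.val = j.val + 1) (k : ℕ) :
    swapY j j' (ySeq n k) = swapSeq (ySeq n) j k := by
  rw [swapSeq]
  by_cases hk : k < n
  · have val_swap : Equiv.swap j.val (j.val + 1) k = (Equiv.swap j j' ⟨k, hk⟩).val := by
      simp only [Equiv.swap_apply_def, Fin.ext_iff, apply_ite Fin.val, hj]
    rw [val_swap, ySeq_val, ← swapY_X_inr, ← ySeq_val]
  · rw [Equiv.swap_apply_of_ne_of_ne (by omega) (by omega), ySeq, dif_neg hk, map_zero]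

theorem ofFn_permState_revPerm (n : ℕ) :
    List.ofFn (permState (Fin.revPerm : Equiv.Perm (Fin n)) n) = descState 0 0 n 0 := by
  refine List.ext_getElem (by simp [descState]) fun k hk hk' => ?_
  have hinv : (Fin.revPerm⁻¹ : Equiv.Perm (Fin n)) = Fin.revPerm := rfl
  simp only [List.getElem_ofFn, permState, hinv, Fin.revPerm_apply, Fin.val_rev, descState,
    List.replicate_zero, List.nil_append, List.append_nil, List.getElem_map,
    List.getElem_reverse, List.getElem_range', List.length_range']
  have hkn : k < n := by simpa using hk
  rw [if_pos (by omega)]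
  congr 1
  omega

theorem prod_range_eq_longestProd (n : ℕ) :
    ∏ k ∈ range n, ∏ j ∈ range (n - 1 - k), (xSeq n k - ySeq n j) = longestProd n := by
  rw [longestProd, prod_filter, ← univ_product_univ, prod_product,
    ← Fin.prod_univ_eq_prod_range (fun k => ∏ j ∈ range (n - 1 - k), (xSeq n k - ySeq n j))]
  refine prod_congr rfl fun k _ => ?_
  simp only [← xSeq_val, ← ySeq_val]
  rw [Fin.prod_univ_eq_prod_range (fun j : ℕ =>
    if k.val + j + 2 ≤ n then xSeq n k - ySeq n j else 1) n, ← prod_filter]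
  refine prod_congr ?_ fun _ _ => rfl
  ext j
  simp only [mem_range, mem_filter]
  omega

section FullLength

variable {n : ℕ} (rows : List (RowType × ℕ))

theorem partitionFn_permState_revPerm (hlen : rows.length = n) (hr : IsNumbered 0 rows) :
    partitionFn (xSeq n) (ySeq n) rows
        (List.ofFn (permState (Fin.revPerm : Equiv.Perm (Fin n)) n)) = longestProd n := by
  subst hlen
  rw [ofFn_permState_revPerm, partitionFn_descState _ _ rows 0 0 0 hr]
  simp only [zero_add, prod_range_eq_longestProd]

theorem yExchange_partitionFn_permState :
    YExchange fun w : Equiv.Perm (Fin n) =>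
      partitionFn (xSeq n) (ySeq n) rows (List.ofFn (permState w n)) := by
  rintro w j ⟨-, hjn⟩ rfl
  have swapY_comp_x : (swapY j ⟨j + 1, hjn⟩).toRingHom ∘ xSeq n = xSeq n :=
    funext (swapY_xSeq _ _)
  have swapY_comp_y : (swapY j ⟨j + 1, hjn⟩).toRingHom ∘ ySeq n = swapSeq (ySeq n) j :=
    funext (swapY_ySeq rfl)
  have hmap := map_partitionFn (swapY j ⟨j + 1, hjn⟩).toRingHom (xSeq n) (ySeq n) rows
    (List.ofFn (permState w n))
  rw [swapY_comp_x, swapY_comp_y, partitionFn_swapSeq _ _ _ _ _ (by simpa using hjn),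
    descentOp_ofFn _ _ hjn] at hmap
  have label_lt : permState w n ⟨j + 1, hjn⟩ < permState w n j ↔ w⁻¹ ⟨j + 1, hjn⟩ < w⁻¹ j := by
    simp [permState]
  have state_swap : permState w n ∘ Equiv.swap j ⟨j + 1, hjn⟩ =
      permState (Equiv.swap j ⟨j + 1, hjn⟩ * w) n := by
    funext k
    simp only [Function.comp_apply, permState, mul_inv_rev, Equiv.swap_inv, Equiv.Perm.mul_apply]
  refine hmap.trans ?_
  simp only [Fin.eta, label_lt, state_swap, ← ySeq_val]

theorem partitionFn_permState_eq_doubleSchubert (hlen : rows.length = n) (hr : IsNumbered 0 rows)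
    (w : Equiv.Perm (Fin n)) :
    partitionFn (xSeq n) (ySeq n) rows (List.ofFn (permState w n)) = doubleSchubert w :=
  (doubleSchubert_eq_of_yExchange (yExchange_partitionFn_permState rows)
    (partitionFn_permState_revPerm rows hlen hr) w).symm

end FullLength

theorem minimalExtension_castLE {m n : ℕ} (hmn : m ≤ n) (π : Fin m ↪ Fin n) (k : Fin m) :
    minimalExtension π (Fin.castLE hmn k) = π k := by
  simp [minimalExtension, minimalExtensionFun]

theorem minimalExtension_lt_minimalExtension {m n : ℕ} (π : Fin m ↪ Fin n) (a b : Fin n)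
    (ha : m ≤ a.val) (hab : a < b) : minimalExtension π a < minimalExtension π b := by
  rw [Fin.lt_def] at hab
  simp only [minimalExtension, Equiv.ofBijective_apply, minimalExtensionFun]
  rw [dif_neg (by omega), dif_neg (by omega), OrderEmbedding.lt_iff_lt, Fin.mk_lt_mk]
  omega

theorem partitionFn_minimalExtension {m n : ℕ} (hmn : m ≤ n) (π : Fin m ↪ Fin n)
    (rows : List (RowType × ℕ)) (hlen : rows.length = m) (hr : IsNumbered 0 rows) :
    partitionFn (xSeq n) (ySeq n) rows (List.ofFn (permState (minimalExtension π) m)) =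
      doubleSchubert (minimalExtension π) := by
  subst hlen
  obtain ⟨d, rfl⟩ := Nat.exists_eq_add_of_le hmn
  rw [← partitionFn_addEastRows _ _ _ rows (minimalExtension_lt_minimalExtension π) d le_rfl]
  exact partitionFn_permState_eq_doubleSchubert _ (length_addEastRows rows d)
    (isNumbered_addEastRows hr d) _

/-! ### Labelled fillings -/

section Cells

/-- The first of the two sides through which pipes enter the tiles of a row of type `b`. Pipes run
through a row of type `west` from `W` and `S` to `N` and `E`, and through a row of type `east` from
`S` and `E` to `W` and `N`; seen along the pipes, `inLeft` is to the left of `inRight`. -/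
def RowType.inLeft : RowType → Side
  | .west => .W
  | .east => .S

/-- The second of the two sides through which pipes enter the tiles of a row of type `b`. -/
def RowType.inRight : RowType → Side
  | .west => .S
  | .east => .E

/-- The first of the two sides through which pipes leave the tiles of a row of type `b`; seen along
the pipes, `outLeft` is to the left of `outRight`. -/
def RowType.outLeft : RowType → Side
  | .west => .N
  | .east => .W

/-- The second of the two sides through which pipes leave the tiles of a row of type `b`. -/
def RowType.outRight : RowType → Side
  | .west => .E
  | .east => .N

variable {ι : Type*}

/-- The label at the West end of a row of type `b` that the pipe labelled `a` enters. -/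
def RowType.westEnd (b : RowType) (a : ι) : WithTop ι := if b = .west then ↑a else ⊤

/-- The label at the East end of a row of type `b` that the pipe labelled `a` enters. -/
def RowType.eastEnd (b : RowType) (a : ι) : WithTop ι := if b = .west then ⊤ else ↑a

/-- The labels on the sides of a tile are compatible with its strands: the sides without a strand
are labelled `⊤`, and the two ends of a strand carry the same label. -/
def Strands (t : Tile) (e : Side → WithTop ι) : Prop :=
  ∀ s, (t.other s = none → e s = ⊤) ∧ ∀ s', t.other s = some s' → e s ≠ ⊤ ∧ e s' = e s

/-- The labelled tile may occur in a row of type `b`. -/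
def IsCellLabelling (b : RowType) (t : Tile) (e : Side → WithTop ι) : Prop :=
  t.Allowed b ∧ Strands t e

/-- The pipes that cross in a tile of a row of type `b` come in uncrossed, that is, in the order of
their labels. -/
def CrossOrder [LT ι] (b : RowType) (t : Tile) (e : Side → WithTop ι) : Prop :=
  t = .cross → e b.inLeft < e b.inRight

/-- The labelling of the sides of a tile with the given values. -/
def sideLabels (W S N E : WithTop ι) : Side → WithTop ι
  | .W => W
  | .S => S
  | .N => N
  | .E => E

/-- The labels on the sides of the tile in column `j` of a row: `H` holds the labels on the vertical
edges, from West to East, and `S` and `N` those on the South and North sides. -/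
def rowLabels (H S N : ℕ → WithTop ι) (j : ℕ) : Side → WithTop ι :=
  sideLabels (H j) (S j) (N j) (H (j + 1))

/-- The labels on the sides of the cell `(i, j)`: `h i j` is the label on its West side and `v i j`
the label on its North side. -/
def cellLabels (h v : ℕ → ℕ → WithTop ι) (i j : ℕ) : Side → WithTop ι :=
  rowLabels (h i) (v (i + 1)) (v i) j

/-- A labelling of the edges of a row of type `b` that the pipe labelled `a` enters. -/
structure IsRowLabelling {n : ℕ} (b : RowType) (a : ι) (t : Fin n → Tile)
    (H S N : ℕ → WithTop ι) : Prop where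
  cell : ∀ j : Fin n, IsCellLabelling b (t j) (rowLabels H S N j)
  west : H 0 = b.westEnd a
  east : H n = b.eastEnd a

/-- A labelling of the edges of the grid in which the pipe labelled `lab i` enters in row `i`. -/
structure IsLabelling {m n : ℕ} (β : Fin m → RowType) (lab : Fin m → ι) (D : Filling m n)
    (h v : ℕ → ℕ → WithTop ι) : Prop where
  row : ∀ i : Fin m, IsRowLabelling (β i) (lab i) (D i) (h i) (v (i + 1)) (v i)
  south : ∀ j : Fin n, v m j = ⊤

/-- The pipes that cross in a tile come in uncrossed, for all tiles. -/
def IsUncrossed [LT ι] {m n : ℕ} (β : Fin m → RowType) (D : Filling m n)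
    (h v : ℕ → ℕ → WithTop ι) : Prop :=
  ∀ (i : Fin m) (j : Fin n), CrossOrder (β i) (D i j) (cellLabels h v i j)

/-- The filling has an uncrossed labelling with the labels `l` on the North side. -/
def HasUncrossedLabelling [LT ι] {m n : ℕ} (β : Fin m → RowType) (lab : Fin m → ι)
    (D : Filling m n) (l : List (WithTop ι)) : Prop :=
  ∃ h v, IsLabelling β lab D h v ∧ IsUncrossed β D h v ∧ (List.ofFn fun j : Fin n => v 0 j) = l

end Cells

/-! ### The partition function as a sum over fillings -/

theorem Side.forall_iff {p : Side → Prop} : (∀ s, p s) ↔ p .N ∧ p .E ∧ p .S ∧ p .W :=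
  ⟨fun h => ⟨h _, h _, h _, h _⟩, fun ⟨h1, h2, h3, h4⟩ s => by cases s <;> assumption⟩

theorem sum_tile {M : Type*} [AddCommMonoid M] (f : Tile → M) :
    ∑ t, f t = f .blank + (f .horiz + (f .vert + (f .cross + (f .elbowWN + (f .elbowSE +
      (f .bumpWNSE + (f .elbowEN + (f .elbowSW + f .bumpENSW)))))))) := by
  have univ_eq : (univ : Finset Tile) = {.blank, .horiz, .vert, .cross, .elbowWN, .elbowSE,
    .bumpWNSE, .elbowEN, .elbowSW, .bumpENSW} := rfl
  rw [univ_eq]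
  simp

/-- The sequence `a, f 0, f 1, …`. -/
def consSeq {α : Type*} (a : α) (f : ℕ → α) : ℕ → α
  | 0 => a
  | k + 1 => f k

theorem sum_fin_cons {α M : Type*} [Fintype α] [AddCommMonoid M] {n : ℕ}
    (f : (Fin (n + 1) → α) → M) :
    ∑ t, f t = ∑ a, ∑ t : Fin n → α, f (Fin.cons a t) := by
  rw [← Fintype.sum_prod_type', ← (Fin.consEquiv fun _ => α).sum_comp]
  rfl

theorem ofFn_val_succ {α : Type*} {n : ℕ} (f : ℕ → α) :
    (List.ofFn fun j : Fin (n + 1) => f j) = f 0 :: List.ofFn fun j : Fin n => f (j + 1) := by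
  rw [List.ofFn_succ]
  rfl

section StateSum

variable {R : Type*} [CommRing R] {ι : Type*} [LinearOrder ι]

open Classical in
/-- The factor contributed by a tile in a row of type `b`, where `c` stands for the difference
`x - y` of the variables of the row and the column. -/
noncomputable def cellWeight (b : RowType) (c : R) (t : Tile) : R :=
  match b with
  | .west => if t.IsStraight then c else 1
  | .east => if t = .blank then c else 1

open Classical in
theorem sum_west_cell (c : R) (n h : WithTop ι) (Q : WithTop ι → WithTop ι → Prop) :
    (∑ t, cellWeight .west c t * if ∃ s w, (IsCellLabelling .west t (sideLabels w s n h) ∧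
        CrossOrder .west t (sideLabels w s n h)) ∧ Q s w then 1 else 0) =
      (if Q h n then 1 else 0) + if h < n then c * (if Q n h then 1 else 0) else 0 := by
  induction n using WithTop.recTopCoe <;> induction h using WithTop.recTopCoe <;>
    simp [sum_tile, IsCellLabelling, Strands, CrossOrder, Side.forall_iff, Tile.other, Side.opp,
      sideLabels, RowType.inLeft, RowType.inRight, Tile.Allowed, cellWeight, Tile.IsStraight] <;>
    (split_ifs <;> simp_all [add_comm])

open Classical in
theorem sum_east_cell (c : R) (n h : WithTop ι) (Q : WithTop ι → WithTop ι → Prop) :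
    (∑ t, cellWeight .east c t * if ∃ s e, (IsCellLabelling .east t (sideLabels h s n e) ∧
        CrossOrder .east t (sideLabels h s n e)) ∧ Q s e then 1 else 0) =
      if h = ⊤ ∧ n = ⊤ then c * (if Q ⊤ ⊤ then 1 else 0)
      else (if n = ⊤ ∨ n < h then (if Q n h then 1 else 0) else 0) +
        if h = ⊤ ∨ n = ⊤ then (if Q h n then 1 else 0) else 0 := by
  induction n using WithTop.recTopCoe <;> induction h using WithTop.recTopCoe <;>
    simp [sum_tile, IsCellLabelling, Strands, CrossOrder, Side.forall_iff, Tile.other, Side.opp,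
      sideLabels, RowType.inLeft, RowType.inRight, Tile.Allowed, cellWeight]
  split_ifs <;> simp_all

theorem rowSum_sum {κ : Type*} (s : Finset κ) (b : RowType) (x : R) (y : ℕ → R)
    (l : List (WithTop ι)) (F : κ → List (WithTop ι) → WithTop ι → R) :
    rowSum b x y l (fun t h => ∑ i ∈ s, F i t h) = ∑ i ∈ s, rowSum b x y l (F i) := by
  classical
  induction s using Finset.induction_on with
  | empty => simp only [sum_empty, rowSum_zero]
  | insert a s ha ih => simp only [sum_insert ha, rowSum_add, ih]

open Classical in
theorem westRow_eq_sum {n : ℕ} (x : R) (y : ℕ → R) (N : ℕ → WithTop ι)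
    (P : List (WithTop ι) → WithTop ι → Prop) :
    westRow x y (List.ofFn fun j : Fin n => N j) (fun s h => if P s h then 1 else 0) =
      ∑ t : Fin n → Tile, (∏ j : Fin n, cellWeight .west (x - y j) (t j)) *
        if ∃ H S : ℕ → WithTop ι, H n = ⊤ ∧
          (∀ j : Fin n, IsCellLabelling .west (t j) (rowLabels H S N j) ∧
            CrossOrder .west (t j) (rowLabels H S N j)) ∧
          P (List.ofFn fun j : Fin n => S j) (H 0) then 1 else 0 := by
  induction n generalizing y N P with
  | zero =>
    have exists_iff : (∃ H : ℕ → WithTop ι, H 0 = ⊤ ∧ P [] (H 0)) ↔ P [] ⊤ :=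
      ⟨fun ⟨_, h1, h2⟩ => h1 ▸ h2, fun h => ⟨fun _ => ⊤, rfl, h⟩⟩
    simp [westRow, exists_iff]
  | succ n ih =>
    rw [ofFn_val_succ, westRow, sum_fin_cons]
    have sum_cell := funext₂ fun s h =>
      (sum_west_cell (x - y 0) (N 0) h fun s₀ w => P (s₀ :: s) w).symm
    rw [sum_cell]
    refine (rowSum_sum _ .west _ _ _ _).trans (sum_congr rfl fun t₀ _ => ?_)
    refine (westRow_mul _ _ _ _ _).trans ?_
    rw [ih (fun k => y (k + 1)) (fun k => N (k + 1)), mul_sum]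
    refine sum_congr rfl fun t _ => ?_
    rw [Fin.prod_univ_succ, ← mul_assoc]
    refine congrArg _ (if_congr ⟨?_, ?_⟩ rfl rfl)
    · rintro ⟨H, S, hn, hc, s₀, w, h0, hP⟩
      refine ⟨consSeq w H, consSeq s₀ S, hn, fun j => Fin.cases h0 hc j, ?_⟩
      rwa [ofFn_val_succ]
    · rintro ⟨H, S, hn, hc, hP⟩
      rw [ofFn_val_succ] at hP
      exact ⟨fun k => H (k + 1), fun k => S (k + 1), hn, fun j => hc j.succ, S 0, H 0, hc 0, hP⟩

open Classical in
theorem eastRow_eq_sum {n : ℕ} (x : R) (y : ℕ → R) (N : ℕ → WithTop ι) (h₀ : WithTop ι)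
    (P : List (WithTop ι) → WithTop ι → Prop) :
    eastRow x y (List.ofFn fun j : Fin n => N j) h₀ (fun s h => if P s h then 1 else 0) =
      ∑ t : Fin n → Tile, (∏ j : Fin n, cellWeight .east (x - y j) (t j)) *
        if ∃ H S : ℕ → WithTop ι, H 0 = h₀ ∧
          (∀ j : Fin n, IsCellLabelling .east (t j) (rowLabels H S N j) ∧
            CrossOrder .east (t j) (rowLabels H S N j)) ∧
          P (List.ofFn fun j : Fin n => S j) (H n) then 1 else 0 := by
  induction n generalizing y N P h₀ with
  | zero =>
    have exists_iff : (∃ H : ℕ → WithTop ι, H 0 = h₀ ∧ P [] (H 0)) ↔ P [] h₀ :=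
      ⟨fun ⟨_, h1, h2⟩ => h1 ▸ h2, fun h => ⟨fun _ => h₀, rfl, h⟩⟩
    simp [eastRow, exists_iff]
  | succ n ih =>
    have sum_ite : ∀ (p q r : Prop) [Decidable p] [Decidable q] [Decidable r] (c : R)
        (W A B C : (Fin n → Tile) → R),
        (if p then c * ∑ t, W t * A t else (if q then ∑ t, W t * B t else 0) +
          if r then ∑ t, W t * C t else 0) =
        ∑ t, W t * (if p then c * A t else (if q then B t else 0) + if r then C t else 0) := by
      intro p q r _ _ _ c W A B C
      split_ifs <;> simp [mul_sum, ← sum_add_distrib, mul_add, mul_left_comm]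
    rw [ofFn_val_succ, eastRow, sum_fin_cons, sum_comm]
    simp only [fun s₀ h₁ => ih (fun k => y (k + 1)) (fun k => N (k + 1)) h₁
      (fun s h => P (s₀ :: s) h)]
    rw [sum_ite]
    refine sum_congr rfl fun t _ => ?_
    rw [← sum_east_cell (x - y 0) (N 0) h₀ (fun s₀ h₁ => ∃ H S : ℕ → WithTop ι, H 0 = h₁ ∧
      (∀ j : Fin n, IsCellLabelling .east (t j) (rowLabels H S (fun k => N (k + 1)) j) ∧
        CrossOrder .east (t j) (rowLabels H S (fun k => N (k + 1)) j)) ∧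
      P (s₀ :: List.ofFn fun j : Fin n => S j) (H n)), mul_sum]
    refine sum_congr rfl fun t₀ _ => ?_
    rw [Fin.prod_univ_succ, mul_left_comm, ← mul_assoc]
    refine congrArg _ (if_congr ⟨?_, ?_⟩ rfl rfl)
    · rintro ⟨s₀, _, h0, H, S, rfl, hc, hP⟩
      refine ⟨consSeq h₀ H, consSeq s₀ S, rfl, fun j => Fin.cases h0 hc j, ?_⟩
      rwa [ofFn_val_succ]
    · rintro ⟨H, S, rfl, hc, hP⟩
      rw [ofFn_val_succ] at hP
      exact ⟨S 0, H 1, hc 0, fun k => H (k + 1), fun k => S (k + 1), rfl, fun j => hc j.succ, hP⟩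

open Classical in
theorem rowSum_eq_sum {n : ℕ} (b : RowType) (a : ι) (x : R) (y : ℕ → R) (N : ℕ → WithTop ι)
    (P : List (WithTop ι) → Prop) :
    rowSum b x y (List.ofFn fun j : Fin n => N j) (fun s h => if h = a ∧ P s then 1 else 0) =
      ∑ t : Fin n → Tile, (∏ j : Fin n, cellWeight b (x - y j) (t j)) *
        if ∃ H S : ℕ → WithTop ι, IsRowLabelling b a t H S N ∧
          (∀ j : Fin n, CrossOrder b (t j) (rowLabels H S N j)) ∧
          P (List.ofFn fun j : Fin n => S j) then 1 else 0 := by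
  cases b
  · refine Eq.trans (by simp only [rowSum]; congr!)
      ((westRow_eq_sum x y N fun s h => h = a ∧ P s).trans (sum_congr rfl fun t _ => ?_))
    refine congrArg _ (if_congr (exists_congr fun H => exists_congr fun S => ?_) rfl rfl)
    rw [forall_and]
    exact ⟨fun ⟨he, ⟨hc, ho⟩, hw, hP⟩ => ⟨⟨hc, hw, he⟩, ho, hP⟩,
      fun ⟨⟨hc, hw, he⟩, ho, hP⟩ => ⟨he, ⟨hc, ho⟩, hw, hP⟩⟩
  · refine Eq.trans (by simp only [rowSum]; congr!)
      ((eastRow_eq_sum x y N ⊤ fun s h => h = a ∧ P s).trans (sum_congr rfl fun t _ => ?_))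
    refine congrArg _ (if_congr (exists_congr fun H => exists_congr fun S => ?_) rfl rfl)
    rw [forall_and]
    exact ⟨fun ⟨hw, ⟨hc, ho⟩, he, hP⟩ => ⟨⟨hc, hw, he⟩, ho, hP⟩,
      fun ⟨⟨hc, hw, he⟩, ho, hP⟩ => ⟨hw, ⟨hc, ho⟩, he, hP⟩⟩

theorem hasUncrossedLabelling_zero_iff {n : ℕ} (β : Fin 0 → RowType) (lab : Fin 0 → ι)
    (D : Filling 0 n) {l : List (WithTop ι)} (hl : l.length = n) :
    HasUncrossedLabelling β lab D l ↔ ∀ a ∈ l, a = ⊤ := by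
  constructor
  · rintro ⟨h, v, H, -, rfl⟩ a ha
    obtain ⟨j, rfl⟩ := (List.mem_ofFn' _ _).1 ha
    exact H.south j
  · intro ha
    refine ⟨fun _ _ => ⊤, fun _ _ => ⊤, ⟨fun i => i.elim0, fun _ => rfl⟩, fun i => i.elim0, ?_⟩
    refine List.ext_getElem (by simp [hl]) fun k _ hk => ?_
    rw [List.getElem_ofFn, ha _ (List.getElem_mem hk)]

theorem hasUncrossedLabelling_cons_iff {m n : ℕ} (β : Fin (m + 1) → RowType)
    (lab : Fin (m + 1) → ι) (t : Fin n → Tile) (D : Filling m n) (N : ℕ → WithTop ι) :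
    HasUncrossedLabelling β lab (Fin.cons t D : Filling (m + 1) n)
        (List.ofFn fun j : Fin n => N j) ↔
      ∃ H S, IsRowLabelling (β 0) (lab 0) t H S N ∧
        (∀ j : Fin n, CrossOrder (β 0) (t j) (rowLabels H S N j)) ∧
        HasUncrossedLabelling (fun i => β i.succ) (fun i => lab i.succ) D
          (List.ofFn fun j : Fin n => S j) := by
  constructor
  · rintro ⟨h, v, ⟨hrow, hsouth⟩, ho, hN⟩
    have hN' : ∀ j : Fin n, rowLabels (h 0) (v 1) N j = cellLabels h v 0 j := fun j => by
      rw [cellLabels, rowLabels, rowLabels, ← congrFun (List.ofFn_injective hN) j]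
    refine ⟨h 0, v 1, ⟨fun j => hN' j ▸ (hrow 0).cell j, (hrow 0).west, (hrow 0).east⟩,
      fun j => hN' j ▸ ho 0 j, fun i => h (i + 1), fun i => v (i + 1),
      ⟨fun i => hrow i.succ, hsouth⟩, fun i => ho i.succ, rfl⟩
  · rintro ⟨H, S, hrow, ho, h, v, ⟨hrows, hsouth⟩, ho', hS⟩
    have hS' : ∀ j : Fin n, rowLabels H (v 0) N j = rowLabels H S N j := fun j => by
      rw [rowLabels, rowLabels, ← congrFun (List.ofFn_injective hS) j]
    have hrow' : IsRowLabelling (β 0) (lab 0) t H (v 0) N :=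
      ⟨fun j => hS' j ▸ hrow.cell j, hrow.west, hrow.east⟩
    refine ⟨consSeq H h, consSeq N v, ⟨fun i => Fin.cases hrow' hrows i, hsouth⟩,
      fun i j => Fin.cases (fun j => ?_) ho' i j, rfl⟩
    exact (hS' j ▸ ho j :)

open Classical in
theorem partitionFn_eq_sum {m n : ℕ} (x : ι → R) (y : ℕ → R) (β : Fin m → RowType)
    (lab : Fin m → ι) (l : List (WithTop ι)) (hl : l.length = n) :
    partitionFn x y (List.ofFn fun i => (β i, lab i)) l =
      ∑ D : Filling m n, (∏ i, ∏ j : Fin n, cellWeight (β i) (x (lab i) - y j) (D i j)) *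
        if HasUncrossedLabelling β lab D l then 1 else 0 := by
  induction m generalizing l with
  | zero =>
    rw [Fintype.sum_unique]
    simp [partitionFn, hasUncrossedLabelling_zero_iff β lab _ hl]
  | succ m ih =>
    obtain ⟨N, rfl⟩ : ∃ N : ℕ → WithTop ι, l = List.ofFn fun j : Fin n => N j := by
      refine ⟨fun k => l.getD k ⊤, List.ext_getElem (by simp [hl]) fun k hk _ => ?_⟩
      rw [List.getElem_ofFn]
      exact (List.getD_eq_getElem _ _ hk).symm
    have tail_sum : ∀ (s : List (WithTop ι)) (h : WithTop ι),
        s.length = (List.ofFn fun j : Fin n => N j).length →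
        (if h = lab 0 then partitionFn x y (List.ofFn fun i : Fin m => (β i.succ, lab i.succ)) s
          else 0) = ∑ D : Filling m n,
          (∏ i : Fin m, ∏ j : Fin n, cellWeight (β i.succ) (x (lab i.succ) - y j) (D i j)) *
          if h = lab 0 ∧ HasUncrossedLabelling (fun i => β i.succ) (fun i => lab i.succ) D s
            then 1 else 0 := by
      intro s h hs
      by_cases hh : h = lab 0
      · simp only [hh, if_true, true_and]
        exact ih _ _ _ (by simpa using hs)
      · simp [hh]
    rw [List.ofFn_succ, partitionFn, rowSum_congr _ _ _ _ tail_sum, rowSum_sum, sum_fin_cons,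
      sum_comm]
    refine sum_congr rfl fun D _ => ?_
    rw [rowSum_mul, rowSum_eq_sum, mul_sum]
    refine sum_congr rfl fun t _ => ?_
    simp only [hasUncrossedLabelling_cons_iff, Fin.prod_univ_succ, Fin.cons_zero, Fin.cons_succ]
    rw [← mul_assoc, mul_comm (∏ i : Fin m, _)]

end StateSum

/-! ### Pairs of pipes that cross twice -/

section Sweep

open scoped List

variable {ι κ : Type*}

theorem pair_sublist_cons_iff {x y a : ι} {l : List ι} :
    [x, y] <+ a :: l ↔ [x, y] <+ l ∨ x = a ∧ y ∈ l := by
  rw [List.sublist_cons_iff]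
  simp

theorem pair_sublist_concat_iff {x y a : ι} {l : List ι} :
    [x, y] <+ l ++ [a] ↔ [x, y] <+ l ∨ y = a ∧ x ∈ l := by
  have reverse_iff : ∀ l' : List ι, [x, y] <+ l' ↔ [y, x] <+ l'.reverse :=
    fun l' => List.reverse_sublist.symm
  rw [reverse_iff, reverse_iff, List.reverse_concat, pair_sublist_cons_iff, List.mem_reverse]

theorem pair_sublist_swap {x y a b : ι} {l₁ l₂ : List ι} (h : [x, y] <+ l₁ ++ b :: a :: l₂) :
    [x, y] <+ l₁ ++ a :: b :: l₂ ∨ x = b ∧ y = a := by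
  induction l₁ with
  | nil =>
    simp only [List.nil_append, pair_sublist_cons_iff, List.mem_cons] at h ⊢
    tauto
  | cons c l₁ ih =>
    simp only [List.cons_append, pair_sublist_cons_iff, List.mem_append, List.mem_cons] at h ⊢
    tauto

theorem not_pair_sublist_of_nodup {x y : ι} {l : List ι} (hl : l.Nodup) (h : [x, y] <+ l) :
    ¬[y, x] <+ l := by
  induction l with
  | nil => simp at h
  | cons a l ih =>
    rw [List.nodup_cons] at hl
    rw [pair_sublist_cons_iff] at h ⊢
    rintro (h' | ⟨rfl, hx⟩)
    · rcases h with h | ⟨rfl, -⟩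
      · exact ih hl.2 h h'
      · exact hl.1 (h'.subset (by simp))
    · rcases h with h | ⟨rfl, -⟩
      · exact hl.1 (h.subset (by simp))
      · exact hl.1 hx

variable [LinearOrder ι] {L R : κ → WithTop ι}

/-- A path sweeps over pipes: `A` is the set of the labels of the pipes that have come in so far,
the word `l` lists these labels in the order in which the pipes meet the path, and `c` is the set of
the crossings that the path has passed. New pipes come in at the ends of the word, in the order of
their labels; in the crossing `k`, the pipe `L k` comes in to the left of the pipe `R k`. -/
inductive Sweep (L R : κ → WithTop ι) : Set ι → List ι → Set κ → Prop
  | nil : Sweep L R ∅ [] ∅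
  | cons {a : ι} {A : Set ι} {l : List ι} {c : Set κ} (ha : ∀ b ∈ A, a < b)
      (h : Sweep L R A l c) : Sweep L R (insert a A) (a :: l) c
  | concat {a : ι} {A : Set ι} {l : List ι} {c : Set κ} (ha : ∀ b ∈ A, b < a)
      (h : Sweep L R A l c) : Sweep L R (insert a A) (l ++ [a]) c
  | cross {a b : ι} {A : Set ι} {l₁ l₂ : List ι} {c : Set κ} {k : κ} (hk : k ∉ c) (hL : L k = a)
      (hR : R k = b) (h : Sweep L R A (l₁ ++ a :: b :: l₂) c) :
      Sweep L R A (l₁ ++ b :: a :: l₂) (insert k c)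

variable {A : Set ι} {l : List ι} {c : Set κ}

theorem Sweep.mem_of_mem (h : Sweep L R A l c) {a : ι} (ha : a ∈ l) : a ∈ A := by
  induction h with
  | nil => simp at ha
  | cons _ _ ih => exact (List.mem_cons.1 ha).imp_right ih
  | concat _ _ ih => exact (List.mem_append.1 ha).symm.imp List.mem_singleton.1 ih
  | cross _ _ _ _ ih => exact ih (((List.Perm.swap _ _ _).append_left _).subset ha)

theorem Sweep.nodup (h : Sweep L R A l c) : l.Nodup := by
  induction h with
  | nil => exact List.nodup_nil
  | cons ha h ih => exact List.nodup_cons.2 ⟨fun hmem => lt_irrefl _ (ha _ (h.mem_of_mem hmem)), ih⟩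
  | concat ha h ih =>
    rw [← List.concat_eq_append, List.nodup_concat]
    exact ⟨fun hmem => lt_irrefl _ (ha _ (h.mem_of_mem hmem)), ih⟩
  | cross _ _ _ _ ih => exact ((List.Perm.swap _ _ _).append_left _).nodup_iff.1 ih

theorem Sweep.ne (h : Sweep L R A l c) {k : κ} (hk : k ∈ c) : L k ≠ R k := by
  induction h with
  | nil => exact hk.elim
  | cons _ _ ih => exact ih hk
  | concat _ _ ih => exact ih hk
  | cross _ hL hR h ih =>
    rcases hk with rfl | hk
    · rw [hL, hR, Ne, WithTop.coe_inj]
      rintro rfl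
      simpa using h.nodup.of_append_right
    · exact ih hk

theorem Sweep.exists_crossing (h : Sweep L R A l c) {a b : ι} (hab : a < b) (hba : [b, a] <+ l) :
    ∃ k ∈ c, s(L k, R k) = s(↑a, ↑b) := by
  induction h with
  | nil => simp at hba
  | cons ha h ih =>
    rcases pair_sublist_cons_iff.1 hba with hba | ⟨rfl, hmem⟩
    · exact ih hba
    · exact absurd hab (ha _ (h.mem_of_mem hmem)).not_gt
  | concat ha h ih =>
    rcases pair_sublist_concat_iff.1 hba with hba | ⟨rfl, hmem⟩
    · exact ih hba
    · exact absurd hab (ha _ (h.mem_of_mem hmem)).not_gt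
  | cross _ hL hR _ ih =>
    rcases pair_sublist_swap hba with hba | ⟨rfl, rfl⟩
    · obtain ⟨k, hk, hkab⟩ := ih hba
      exact ⟨k, Set.mem_insert_of_mem _ hk, hkab⟩
    · exact ⟨_, Set.mem_insert _ _, by rw [hL, hR]⟩

theorem Sweep.pair_sublist (h : Sweep L R A l c)
    (hc : ∀ k ∈ c, L k < R k) {k : κ} (hk : k ∈ c) {a b : ι} (hL : L k = a) (hR : R k = b) :
    [b, a] <+ l := by
  induction h with
  | nil => exact hk.elim
  | cons _ _ ih => exact (ih hc hk).cons _
  | concat _ _ ih => exact (ih hc hk).trans (List.sublist_append_left _ _)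
  | @cross a' b' A l₁ l₂ c k' _ hL' hR' _ ih =>
    have hlt : a' < b' := by
      rw [← WithTop.coe_lt_coe, ← hL', ← hR']
      exact hc k' (Set.mem_insert _ _)
    rcases hk with rfl | hk
    · obtain rfl : a' = a := WithTop.coe_injective (hL'.symm.trans hL)
      obtain rfl : b' = b := WithTop.coe_injective (hR'.symm.trans hR)
      simp
    · refine (pair_sublist_swap (ih (fun k hk => hc k (Or.inr hk)) hk)).resolve_right ?_
      rintro ⟨rfl, rfl⟩
      have := hc k (Or.inr hk)
      rw [hL, hR, WithTop.coe_lt_coe] at this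
      exact hlt.not_gt this

/- As long as all pipes have crossed in order, two labels are inverted in the word exactly if their
pipes have crossed: a crossing out of order is the second crossing of its pipes. -/
theorem Sweep.forall_lt_iff_injOn (h : Sweep L R A l c) :
    (∀ k ∈ c, L k < R k) ↔ c.InjOn fun k => s(L k, R k) := by
  induction h with
  | nil => simp
  | cons _ _ ih => exact ih
  | concat _ _ ih => exact ih
  | @cross a b A l₁ l₂ c k hk hL hR h ih =>
    rw [Set.forall_mem_insert, Set.injOn_insert hk, ← ih, and_comm]
    refine and_congr_right fun hc => ?_
    have hab : [a, b] <+ l₁ ++ a :: b :: l₂ := by simp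
    constructor
    · rintro hlt ⟨k', hk', heq⟩
      have hlt' := hc k' hk'
      obtain ⟨hL', hR'⟩ | ⟨hL', hR'⟩ := Sym2.eq_iff.1 heq
      · exact not_pair_sublist_of_nodup h.nodup hab
          (h.pair_sublist hc hk' (hL'.trans hL) (hR'.trans hR))
      · rw [hL', hR'] at hlt'
        exact hlt.not_gt hlt'
    · intro hnew
      rw [hL, hR, WithTop.coe_lt_coe]
      by_contra hlt
      have hne : a ≠ b := by
        rintro rfl
        exact not_pair_sublist_of_nodup h.nodup hab hab
      obtain ⟨k', hk', heq⟩ := h.exists_crossing (lt_of_le_of_ne (not_lt.1 hlt) hne.symm) hab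
      exact hnew ⟨k', hk', heq.trans (by rw [hL, hR, Sym2.eq_swap])⟩

end Sweep

section Grid

variable {ι : Type*}

/-- The word of an edge label: empty for `⊤`, and of length one for the label of a pipe. -/
def toWord : WithTop ι → List ι
  | ⊤ => []
  | (a : ι) => [a]

theorem toWord_top : toWord (⊤ : WithTop ι) = [] := rfl

/-- The word of the labels of pipes among `f p, …, f (q - 1)`. -/
def labelWord (f : ℕ → WithTop ι) (p q : ℕ) : List ι :=
  (List.Ico p q).flatMap fun k => toWord (f k)

theorem labelWord_self (f : ℕ → WithTop ι) (p : ℕ) : labelWord f p p = [] := by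
  simp [labelWord]

theorem labelWord_succ (f : ℕ → WithTop ι) {p q : ℕ} (h : p ≤ q) :
    labelWord f p (q + 1) = labelWord f p q ++ toWord (f q) := by
  simp [labelWord, List.Ico.succ_top h]

theorem labelWord_eq_append (f : ℕ → WithTop ι) {p q : ℕ} (h : p < q) :
    labelWord f p q = toWord (f p) ++ labelWord f (p + 1) q := by
  simp [labelWord, List.Ico.eq_cons h]

theorem IsCellLabelling.toWord_append {b : RowType} {t : Tile} {e : Side → WithTop ι}
    (h : IsCellLabelling b t e) (ht : t ≠ .cross) :
    toWord (e b.outLeft) ++ toWord (e b.outRight) =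
      toWord (e b.inLeft) ++ toWord (e b.inRight) := by
  obtain ⟨ha, hs⟩ := h
  rw [Strands, Side.forall_iff] at hs
  cases b <;> cases t <;>
    simp [Tile.Allowed, Tile.other, RowType.inLeft, RowType.inRight, RowType.outLeft,
      RowType.outRight] at ha ht hs ⊢ <;>
    grind [toWord_top]

theorem IsCellLabelling.exists_of_cross {b : RowType} {e : Side → WithTop ι}
    (h : IsCellLabelling b .cross e) :
    ∃ x y : ι, e b.inLeft = x ∧ e b.inRight = y ∧ e b.outLeft = y ∧ e b.outRight = x := by
  have hs : ∀ s, e s ≠ ⊤ ∧ e s.opp = e s := fun s => (h.2 s).2 _ rfl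
  obtain ⟨x, hx⟩ := WithTop.ne_top_iff_exists.1 (hs b.inLeft).1
  obtain ⟨y, hy⟩ := WithTop.ne_top_iff_exists.1 (hs b.inRight).1
  refine ⟨x, y, hx.symm, hy.symm, ?_⟩
  rw [hx, hy]
  cases b
  · exact ⟨(hs .S).2, (hs .W).2⟩
  · exact ⟨(hs .E).2, (hs .S).2⟩

/-- The crossings of a filling. -/
def crossings {m n : ℕ} (D : Filling m n) : Set (Fin m × Fin n) := {p | D p.1 p.2 = .cross}

variable {m n : ℕ} {β : Fin m → RowType} {lab : Fin m → ι} {D : Filling m n}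
  {h v : ℕ → ℕ → WithTop ι}

/-- The label of the pipe that comes into the given cell on the left. -/
def leftLabel (β : Fin m → RowType) (h v : ℕ → ℕ → WithTop ι) (p : Fin m × Fin n) : WithTop ι :=
  cellLabels h v p.1 p.2 (β p.1).inLeft

/-- The label of the pipe that comes into the given cell on the right. -/
def rightLabel (β : Fin m → RowType) (h v : ℕ → ℕ → WithTop ι) (p : Fin m × Fin n) : WithTop ι :=
  cellLabels h v p.1 p.2 (β p.1).inRight

variable [LinearOrder ι] {A : Set ι}

theorem isUncrossed_iff :
    IsUncrossed β D h v ↔ ∀ p ∈ crossings D, leftLabel β h v p < rightLabel β h v p :=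
  ⟨fun H p => H p.1 p.2, fun H i j => H (i, j)⟩

theorem Sweep.cell {i : Fin m} {j : Fin n} {l₁ l₂ : List ι} {Q : Set (Fin m × Fin n)}
    (hc : IsCellLabelling (β i) (D i j) (cellLabels h v i j)) (hQ : (i, j) ∉ Q)
    (H : Sweep (leftLabel β h v) (rightLabel β h v) A
      (l₁ ++ (toWord (cellLabels h v i j (β i).inLeft) ++
        (toWord (cellLabels h v i j (β i).inRight) ++ l₂))) (crossings D ∩ Q)) :
    Sweep (leftLabel β h v) (rightLabel β h v) A
      (l₁ ++ (toWord (cellLabels h v i j (β i).outLeft) ++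
        (toWord (cellLabels h v i j (β i).outRight) ++ l₂))) (crossings D ∩ insert (i, j) Q) := by
  by_cases ht : D i j = .cross
  · rw [ht] at hc
    obtain ⟨x, y, hx, hy, hy', hx'⟩ := hc.exists_of_cross
    rw [hx, hy] at H
    rw [hx', hy', Set.inter_insert_of_mem (show (i, j) ∈ crossings D from ht)]
    exact Sweep.cross (fun hmem => hQ hmem.2) hx hy H
  · rw [Set.inter_insert_of_notMem (show (i, j) ∉ crossings D from ht),
      ← List.append_assoc (toWord _), hc.toWord_append ht, List.append_assoc]
    exact H

theorem Sweep.west_row {i : Fin m} (hβ : β i = .west)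
    (hc : ∀ j : Fin n, IsCellLabelling (β i) (D i j) (cellLabels h v i j))
    (H : Sweep (leftLabel β h v) (rightLabel β h v) A
      (toWord (h i 0) ++ labelWord (v (i + 1)) 0 n) (crossings D ∩ {p | i < p.1})) {j : ℕ}
    (hj : j ≤ n) :
    Sweep (leftLabel β h v) (rightLabel β h v) A
      (labelWord (v i) 0 j ++ (toWord (h i j) ++ labelWord (v (i + 1)) j n))
      (crossings D ∩ {p | i < p.1 ∨ p.1 = i ∧ p.2 < j}) := by
  induction j with
  | zero => simpa [labelWord_self] using H
  | succ j ih =>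
    have IH := ih (by omega)
    rw [labelWord_eq_append _ hj] at IH
    have fresh : (i, ⟨j, hj⟩) ∉ {p : Fin m × Fin n | i < p.1 ∨ p.1 = i ∧ p.2 < j} := by simp
    have step := Sweep.cell (hc ⟨j, hj⟩) fresh (by rw [hβ]; exact IH)
    rw [hβ] at step
    convert step using 1
    · rw [labelWord_succ _ (Nat.zero_le j), List.append_assoc]
      rfl
    · congr 1
      ext p
      simp only [Set.mem_insert_iff, Set.mem_ofPred_eq, Prod.ext_iff, Fin.ext_iff]
      omega

theorem Sweep.east_row {i : Fin m} (hβ : β i = .east)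
    (hc : ∀ j : Fin n, IsCellLabelling (β i) (D i j) (cellLabels h v i j))
    (H : Sweep (leftLabel β h v) (rightLabel β h v) A
      (labelWord (v (i + 1)) 0 n ++ toWord (h i n)) (crossings D ∩ {p | i < p.1})) {j : ℕ}
    (hj : j ≤ n) :
    Sweep (leftLabel β h v) (rightLabel β h v) A
      (labelWord (v (i + 1)) 0 j ++ (toWord (h i j) ++ labelWord (v i) j n))
      (crossings D ∩ {p | i < p.1 ∨ p.1 = i ∧ j ≤ p.2}) := by
  induction hj using Nat.decreasingInduction with
  | self =>
    simpa [labelWord_self, show ∀ j : Fin n, ¬n ≤ j from fun j => j.isLt.not_ge] using H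
  | of_succ j hj IH =>
    rw [labelWord_succ _ (Nat.zero_le j), List.append_assoc] at IH
    have fresh : (i, ⟨j, hj⟩) ∉ {p : Fin m × Fin n | i < p.1 ∨ p.1 = i ∧ j + 1 ≤ p.2} := by simp
    have step := Sweep.cell (hc ⟨j, hj⟩) fresh (by rw [hβ]; exact IH)
    rw [hβ] at step
    convert step using 1
    · rw [labelWord_eq_append _ hj]
      rfl
    · congr 1
      ext p
      simp only [Set.mem_insert_iff, Set.mem_ofPred_eq, Prod.ext_iff, Fin.ext_iff]
      omega

/-- The order of the labels is the order, counterclockwise from the Northwest corner, in which the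
pipes enter. -/
def IsEntryOrder (β : Fin m → RowType) (lab : Fin m → ι) : Prop :=
  ∀ i r, i < r → (β i = .west → lab i < lab r) ∧ (β i = .east → lab r < lab i)

theorem Sweep.row (hlab : IsEntryOrder β lab) (H : IsLabelling β lab D h v) (i : Fin m)
    (hS : Sweep (leftLabel β h v) (rightLabel β h v) (lab '' {r | i < r})
      (labelWord (v (i + 1)) 0 n) (crossings D ∩ {p | i < p.1})) :
    Sweep (leftLabel β h v) (rightLabel β h v) (lab '' {r | i ≤ r})
      (labelWord (v i) 0 n) (crossings D ∩ {p | i ≤ p.1}) := by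
  obtain ⟨hc, hw, he⟩ := H.row i
  have hA : lab '' {r | i ≤ r} = insert (lab i) (lab '' {r | i < r}) := by
    rw [← Set.image_insert_eq]
    congr 1
    ext r
    simp [le_iff_eq_or_lt, eq_comm]
  have hQ : {p : Fin m × Fin n | i ≤ p.1} = {p | i < p.1 ∨ p.1 = i} := by
    ext p
    simp [le_iff_lt_or_eq, eq_comm]
  rw [hA, hQ]
  cases hβ : β i <;> simp only [hβ, RowType.westEnd, RowType.eastEnd, if_true, reduceCtorEq,
    if_false] at hw he
  · have entry := hS.cons (a := lab i) (by rintro _ ⟨r, hr, rfl⟩; exact (hlab i r hr).1 hβ)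
    have row := Sweep.west_row hβ hc (by rw [hw]; exact entry) le_rfl
    simpa [he, toWord, labelWord_self] using row
  · have entry := hS.concat (a := lab i) (by rintro _ ⟨r, hr, rfl⟩; exact (hlab i r hr).2 hβ)
    have row := Sweep.east_row hβ hc (by rw [he]; exact entry) (Nat.zero_le n)
    simpa [hw, toWord, labelWord_self] using row

theorem sweep_grid (hlab : IsEntryOrder β lab) (H : IsLabelling β lab D h v) {i : ℕ}
    (hi : i ≤ m) :
    Sweep (leftLabel β h v) (rightLabel β h v) (lab '' {r | i ≤ r})
      (labelWord (v i) 0 n) (crossings D ∩ {p | i ≤ p.1}) := by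
  induction hi using Nat.decreasingInduction with
  | self =>
    have hv : labelWord (v m) 0 n = [] := by
      rw [labelWord, List.flatMap_eq_nil_iff]
      intro k hk
      rw [H.south ⟨k, (List.Ico.mem.1 hk).2⟩]
      rfl
    simpa [hv, show ∀ r : Fin m, ¬m ≤ r from fun r => r.isLt.not_ge] using Sweep.nil
  | of_succ i hi IH => exact Sweep.row hlab H ⟨i, hi⟩ IH

theorem IsLabelling.sweep (H : IsLabelling β lab D h v) (hlab : IsEntryOrder β lab) :
    Sweep (leftLabel β h v) (rightLabel β h v) (Set.range lab) (labelWord (v 0) 0 n)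
      (crossings D) := by
  simpa only [Nat.zero_le, Set.ofPred_true, Set.inter_univ, Set.image_univ] using
    sweep_grid hlab H (Nat.zero_le m)

theorem IsLabelling.isUncrossed_iff_injOn (H : IsLabelling β lab D h v)
    (hlab : IsEntryOrder β lab) :
    IsUncrossed β D h v ↔
      (crossings D).InjOn fun p => s(leftLabel β h v p, rightLabel β h v p) := by
  rw [isUncrossed_iff, (H.sweep hlab).forall_lt_iff_injOn]

theorem IsLabelling.exists_north_eq (H : IsLabelling β lab D h v) (hlab : IsEntryOrder β lab)
    {c : Fin n} (hc : v 0 c ≠ ⊤) : ∃ r, v 0 c = lab r := by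
  obtain ⟨a, ha⟩ := WithTop.ne_top_iff_exists.1 hc
  have hmem : a ∈ labelWord (v 0) 0 n :=
    List.mem_flatMap.2 ⟨c, List.Ico.mem.2 ⟨Nat.zero_le _, c.isLt⟩, by simp [← ha, toWord]⟩
  obtain ⟨r, rfl⟩ := (H.sweep hlab).mem_of_mem hmem
  exact ⟨r, ha.symm⟩

theorem IsLabelling.north_injective (H : IsLabelling β lab D h v) (hlab : IsEntryOrder β lab)
    {c c' : Fin n} {a : ι} (hc : v 0 c = a) (hc' : v 0 c' = a) : c = c' := by
  have disjoint := (List.nodup_flatMap.1 (H.sweep hlab).nodup).2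
  by_contra hne
  have mem_Ico : ∀ k : Fin n, k.val ∈ List.Ico 0 n := fun k =>
    List.Ico.mem.2 ⟨Nat.zero_le _, k.isLt⟩
  have : Std.Symm (Function.onFun List.Disjoint fun k => toWord (v 0 k)) :=
    ⟨fun _ _ h => List.Disjoint.symm h⟩
  have hd := disjoint.forall (mem_Ico c) (mem_Ico c') (Fin.val_injective.ne hne)
  exact hd (a := a) (by simp [hc, toWord]) (by simp [hc', toWord])

theorem IsEntryOrder.injective (hlab : IsEntryOrder β lab) : Function.Injective lab := by
  refine .of_lt_imp_ne fun i r hir => ?_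
  cases hβ : β i
  · exact ((hlab i r hir).1 hβ).ne
  · exact ((hlab i r hir).2 hβ).ne'

end Grid

/-! ### Pipes and labels -/

/-- Pipes enter the tiles of a row of type `b` through the side `s`. -/
def RowType.IsInput (b : RowType) (s : Side) : Prop := s = b.inLeft ∨ s = b.inRight

theorem RowType.not_isInput_N (b : RowType) : ¬b.IsInput .N := by
  cases b <;> simp [RowType.IsInput, RowType.inLeft, RowType.inRight]

theorem RowType.eq_in_or_out (b : RowType) (s : Side) :
    s = b.inLeft ∨ s = b.inRight ∨ s = b.outLeft ∨ s = b.outRight := by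
  cases b <;> cases s <;> decide

theorem Side.opp_opp (s : Side) : s.opp.opp = s := by cases s <;> rfl

theorem Tile.Allowed.isInput_of_other {b : RowType} {t : Tile} (ht : t.Allowed b) {s s' : Side}
    (hs : ¬b.IsInput s) (h : t.other s = some s') : b.IsInput s' ∧ t.other s' = some s := by
  cases b <;> cases t <;> cases s <;> cases s' <;>
    simp_all [Tile.Allowed, Tile.other, RowType.IsInput, RowType.inLeft, RowType.inRight, Side.opp]

section

variable {ι : Type*}

theorem Strands.touches_iff {t : Tile} {e : Side → WithTop ι} (h : Strands t e) (s : Side) :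
    t.Touches s ↔ e s ≠ ⊤ := by
  refine ⟨fun ht => ?_, fun he ht => he ((h s).1 ht)⟩
  obtain ⟨s', hs'⟩ := Option.ne_none_iff_exists'.1 ht
  exact ((h s).2 s' hs').1

theorem IsCellLabelling.exists_input {b : RowType} {t : Tile} {e : Side → WithTop ι}
    (h : IsCellLabelling b t e) {s : Side} (hs : ¬b.IsInput s) (he : e s ≠ ⊤) :
    ∃ s', b.IsInput s' ∧ t.other s' = some s ∧ e s' = e s := by
  obtain ⟨s', hs'⟩ := Option.ne_none_iff_exists'.1 ((h.2.touches_iff s).2 he)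
  obtain ⟨hin, hother⟩ := h.1.isInput_of_other hs hs'
  exact ⟨s', hin, hother, ((h.2 s).2 s' hs').2⟩

variable {m n : ℕ} {β : Fin m → RowType} {lab : Fin m → ι} {D : Filling m n}
  {h v : ℕ → ℕ → WithTop ι}

theorem Neighbor.symm {s : Side} {i i' : Fin m} {j j' : Fin n} (hN : Neighbor s i j i' j') :
    Neighbor s.opp i' j' i j := by
  cases s <;> exact ⟨hN.1.symm, hN.2.symm⟩

theorem cellLabels_of_neighbor {s : Side} {i i' : Fin m} {j j' : Fin n}
    (hN : Neighbor s i j i' j') : cellLabels h v i' j' s.opp = cellLabels h v i j s := by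
  cases s <;> obtain ⟨hi, hj⟩ := hN <;>
    simp only [cellLabels, rowLabels, sideLabels, Side.opp, hi, hj]

theorem cellLabels_of_isEntry (H : IsLabelling β lab D h v) {r : Fin m} {p : Place m n}
    (hp : IsEntry β r p) : cellLabels h v p.row p.col p.side = lab r := by
  obtain ⟨rfl, ⟨hβ, hc, hs⟩ | ⟨hβ, hc, hs⟩⟩ := hp
  · simpa [cellLabels, rowLabels, sideLabels, hs, hc, RowType.westEnd, hβ] using
      (H.row p.row).west
  · simpa [cellLabels, rowLabels, sideLabels, hs, hc, RowType.eastEnd, hβ] using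
      (H.row p.row).east

theorem Visits.cellLabels_eq (H : IsLabelling β lab D h v) {r : Fin m} {p : Place m n}
    (hp : Visits β D r p) : cellLabels h v p.row p.col p.side = lab r := by
  obtain ⟨p₀, hentry, hsteps⟩ := hp
  induction hsteps with
  | refl => exact cellLabels_of_isEntry H hentry
  | @tail p q _ hstep ih =>
    obtain ⟨s, hother, hN, hside⟩ := hstep
    have strand := (((H.row p.row).cell p.col).2 p.side).2 s hother
    rw [hside, cellLabels_of_neighbor hN, ← ih]
    exact strand.2

theorem Visits.step {r : Fin m} {i i' : Fin m} {j j' : Fin n} {s s' : Side}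
    (hp : Visits β D r ⟨i, j, s⟩) (ho : (D i j).other s = some s') (hN : Neighbor s' i j i' j') :
    Visits β D r ⟨i', j', s'.opp⟩ := by
  obtain ⟨p₀, hentry, hsteps⟩ := hp
  exact ⟨p₀, hentry, hsteps.tail ⟨s', ho, hN, rfl⟩⟩

theorem RowType.IsInput.isEntry_or_exists_neighbor {i : Fin m} {j : Fin n} {s : Side}
    (hs : (β i).IsInput s) :
    IsEntry β i ⟨i, j, s⟩ ∨ (s = .S ∧ i.val + 1 = m) ∨
      ∃ i' j', Neighbor s i j i' j' ∧ ¬(β i').IsInput s.opp ∧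
        (i < i' ∨ i' = i ∧ if β i = .west then j' < j else j < j') := by
  have south : (Side.S = .S ∧ i.val + 1 = m) ∨
      ∃ i' j', Neighbor .S i j i' j' ∧ ¬(β i').IsInput .N ∧
        (i < i' ∨ i' = i ∧ if β i = .west then j' < j else j < j') := by
    by_cases hi : i.val + 1 = m
    · exact .inl ⟨rfl, hi⟩
    · exact .inr ⟨⟨i + 1, by omega⟩, j, ⟨rfl, rfl⟩, RowType.not_isInput_N _,
        .inl (Nat.lt_succ_self i)⟩
  cases hβ : β i <;> rw [hβ] at hs south <;> rcases hs with rfl | rfl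
  · by_cases hj : j.val = 0
    · exact .inl ⟨rfl, .inl ⟨hβ, hj, rfl⟩⟩
    · refine .inr (.inr ⟨i, ⟨j - 1, by omega⟩, ⟨rfl, Nat.sub_add_cancel (by omega)⟩, ?_,
        .inr ⟨rfl, Nat.sub_lt (by omega) one_pos⟩⟩)
      simp [hβ, RowType.IsInput, RowType.inLeft, RowType.inRight, Side.opp]
  · exact .inr south
  · exact .inr south
  · by_cases hj : j.val + 1 = n
    · exact .inl ⟨rfl, .inr ⟨hβ, hj, rfl⟩⟩
    · refine .inr (.inr ⟨i, ⟨j + 1, by omega⟩, ⟨rfl, rfl⟩, ?_,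
        .inr ⟨rfl, Nat.lt_succ_self j⟩⟩)
      simp [hβ, RowType.IsInput, RowType.inLeft, RowType.inRight, Side.opp]

theorem IsLabelling.exists_visits (H : IsLabelling β lab D h v) {i : Fin m} {j : Fin n} {s : Side}
    (hs : (β i).IsInput s) (hl : cellLabels h v i j s ≠ ⊤) : ∃ r, Visits β D r ⟨i, j, s⟩ := by
  obtain hentry | ⟨rfl, hi⟩ | ⟨i', j', hN, hout, hlt⟩ := hs.isEntry_or_exists_neighbor (j := j)
  · exact ⟨i, _, hentry, .refl⟩
  · have hv := H.south j
    rw [← hi] at hv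
    exact absurd hv hl
  · obtain ⟨s', hin, hother, heq⟩ :=
      ((H.row i').cell j').exists_input hout ((cellLabels_of_neighbor hN).trans_ne hl)
    obtain ⟨r, hr⟩ := H.exists_visits hin (heq.trans_ne ((cellLabels_of_neighbor hN).trans_ne hl))
    refine ⟨r, ?_⟩
    simpa only [Side.opp_opp] using hr.step hother hN.symm
termination_by (m - i.val, if β i = .west then j.val else n - j.val)
decreasing_by
  rw [Prod.lex_def]
  rcases hlt with hlt | ⟨rfl, hlt⟩
  · exact Or.inl (by simp only; omega)
  · refine Or.inr ⟨rfl, ?_⟩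
    simp only
    split_ifs at hlt ⊢ <;> omega

theorem IsLabelling.exitsAt_iff (H : IsLabelling β lab D h v) (hlab : Function.Injective lab)
    (r : Fin m) (c : Fin n) : ExitsAt β D r c ↔ v 0 c = lab r := by
  constructor
  · rintro ⟨⟨i, j, s⟩, hp, hi, rfl, hother⟩
    have strand := (((H.row i).cell j).2 s).2 .N hother
    have hN := strand.2.trans (hp.cellLabels_eq H)
    simp only at hi
    rw [← hi]
    exact hN
  · intro hv
    have hm : 0 < m := r.pos
    have hN : cellLabels h v (⟨0, hm⟩ : Fin m) c .N = lab r := hv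
    obtain ⟨s, hin, hother, heq⟩ := ((H.row ⟨0, hm⟩).cell c).exists_input
      (RowType.not_isInput_N _) (hN.trans_ne WithTop.coe_ne_top)
    obtain ⟨r', hr'⟩ := H.exists_visits hin (heq.trans_ne (hN.trans_ne WithTop.coe_ne_top))
    have hlabel := (hr'.cellLabels_eq H).symm.trans (heq.trans hN)
    obtain rfl := hlab (WithTop.coe_injective hlabel)
    exact ⟨_, hr', rfl, rfl, hother⟩

theorem IsLabelling.exists_visits_iff_of_cross (H : IsLabelling β lab D h v)
    (hlab : Function.Injective lab) {i : Fin m} {j : Fin n} (hc : D i j = .cross) (r : Fin m) :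
    (∃ s, Visits β D r ⟨i, j, s⟩) ↔
      (lab r : WithTop ι) ∈ s(leftLabel β h v (i, j), rightLabel β h v (i, j)) := by
  have cell := (H.row i).cell j
  rw [hc] at cell
  obtain ⟨x, y, hx, hy, hy', hx'⟩ := cell.exists_of_cross
  rw [Sym2.mem_iff]
  constructor
  · rintro ⟨s, hs⟩
    have hlabel : cellLabels h v i j s = lab r := hs.cellLabels_eq H
    obtain rfl | rfl | rfl | rfl := (β i).eq_in_or_out s
    · exact .inl hlabel.symm
    · exact .inr hlabel.symm
    · exact .inr (hlabel.symm.trans (hy'.trans hy.symm))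
    · exact .inl (hlabel.symm.trans (hx'.trans hx.symm))
  · have visits_of_input : ∀ s, (β i).IsInput s → cellLabels h v i j s = lab r →
        ∃ s, Visits β D r ⟨i, j, s⟩ := by
      intro s hin hs
      obtain ⟨r', hr'⟩ := H.exists_visits hin (hs.trans_ne WithTop.coe_ne_top)
      obtain rfl := hlab (WithTop.coe_injective ((hr'.cellLabels_eq H).symm.trans hs))
      exact ⟨s, hr'⟩
    rintro (hL | hR)
    · exact visits_of_input _ (.inl rfl) hL.symm
    · exact visits_of_input _ (.inr rfl) hR.symm

theorem IsLabelling.crossAt_iff (H : IsLabelling β lab D h v) (hlab : Function.Injective lab)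
    {r r' : Fin m} {i : Fin m} {j : Fin n} :
    CrossAt β D r r' i j ↔ r ≠ r' ∧ (i, j) ∈ crossings D ∧
      s(leftLabel β h v (i, j), rightLabel β h v (i, j)) = s(↑(lab r), ↑(lab r')) := by
  refine and_congr_right fun hne => and_congr_right fun hc => ?_
  rw [H.exists_visits_iff_of_cross hlab hc, H.exists_visits_iff_of_cross hlab hc,
    Sym2.mem_and_mem_iff (WithTop.coe_injective.ne (hlab.ne hne))]

theorem IsLabelling.exists_labels_of_cross (H : IsLabelling β lab D h v) {p : Fin m × Fin n}
    (hp : p ∈ crossings D) (hne : leftLabel β h v p ≠ rightLabel β h v p) :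
    ∃ r r', r ≠ r' ∧ s(leftLabel β h v p, rightLabel β h v p) = s(↑(lab r), ↑(lab r')) := by
  have cell := (H.row p.1).cell p.2
  rw [show D p.1 p.2 = .cross from hp] at cell
  obtain ⟨x, y, hx, hy, -⟩ := cell.exists_of_cross
  obtain ⟨r, hr⟩ := H.exists_visits (.inl rfl) (hx.trans_ne WithTop.coe_ne_top)
  obtain ⟨r', hr'⟩ := H.exists_visits (.inr rfl) (hy.trans_ne WithTop.coe_ne_top)
  have hL : leftLabel β h v p = lab r := hr.cellLabels_eq H
  have hR : rightLabel β h v p = lab r' := hr'.cellLabels_eq H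
  refine ⟨r, r', ?_, by rw [hL, hR]⟩
  rintro rfl
  exact hne (hL.trans hR.symm)

theorem IsLabelling.no_double_crossing_iff [LinearOrder ι] (H : IsLabelling β lab D h v)
    (hlab : IsEntryOrder β lab) :
    (∀ r r' i j i' j', CrossAt β D r r' i j → CrossAt β D r r' i' j' → i = i' ∧ j = j') ↔
      IsUncrossed β D h v := by
  have hinj := hlab.injective
  rw [H.isUncrossed_iff_injOn hlab]
  constructor
  · intro hD p hp q hq heq
    obtain ⟨r, r', hne, hlabels⟩ := H.exists_labels_of_cross hp ((H.sweep hlab).ne hp)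
    exact Prod.ext_iff.2 (hD r r' _ _ _ _ ((H.crossAt_iff hinj).2 ⟨hne, hp, hlabels⟩)
      ((H.crossAt_iff hinj).2 ⟨hne, hq, heq.symm.trans hlabels⟩))
  · intro hinjOn r r' i j i' j' hcross hcross'
    obtain ⟨-, hp, hlabels⟩ := (H.crossAt_iff hinj).1 hcross
    obtain ⟨-, hp', hlabels'⟩ := (H.crossAt_iff hinj).1 hcross'
    exact Prod.ext_iff.1 (hinjOn hp hp' (hlabels.trans hlabels'.symm))

end

/-! ### Existence of labellings -/

section Existence

variable {ι : Type*}

theorem exists_strands_west {t : Tile} (ht : t.Allowed .west) {W S : WithTop ι}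
    (hW : t.Touches .W ↔ W ≠ ⊤) (hS : t.Touches .S ↔ S ≠ ⊤) :
    ∃ N E, Strands t (sideLabels W S N E) := by
  refine ⟨if t.other .N = some .W then W else if t.other .N = some .S then S else ⊤,
    if t.other .E = some .W then W else if t.other .E = some .S then S else ⊤, ?_⟩
  rw [Strands, Side.forall_iff]
  cases t <;> simp_all [Tile.Allowed, Tile.Touches, Tile.other, Side.opp, sideLabels]

theorem exists_strands_east {t : Tile} (ht : t.Allowed .east) {S E : WithTop ι}
    (hS : t.Touches .S ↔ S ≠ ⊤) (hE : t.Touches .E ↔ E ≠ ⊤) :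
    ∃ W N, Strands t (sideLabels W S N E) := by
  refine ⟨if t.other .W = some .E then E else if t.other .W = some .S then S else ⊤,
    if t.other .N = some .E then E else if t.other .N = some .S then S else ⊤, ?_⟩
  rw [Strands, Side.forall_iff]
  cases t <;> simp_all [Tile.Allowed, Tile.Touches, Tile.other, Side.opp, sideLabels]

theorem exists_strands_row_west {n : ℕ} {t : Fin n → Tile} (S : ℕ → WithTop ι) (a : WithTop ι)
    (ht : ∀ j, (t j).Allowed .west)
    (matching : ∀ j j' : Fin n, j'.val = j.val + 1 → ((t j).Touches .E ↔ (t j').Touches .W))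
    (south : ∀ j, (t j).Touches .S ↔ S j ≠ ⊤)
    (west : ∀ j : Fin n, j.val = 0 → ((t j).Touches .W ↔ a ≠ ⊤)) :
    ∃ H N : ℕ → WithTop ι, H 0 = a ∧ ∀ j : Fin n, Strands (t j) (rowLabels H S N j) := by
  induction n generalizing S a with
  | zero => exact ⟨fun _ => a, fun _ => ⊤, rfl, fun j => j.elim0⟩
  | succ n ih =>
    obtain ⟨b, c, hbc⟩ := exists_strands_west (ht 0) (west 0 rfl) (south 0)
    obtain ⟨H, N, hH, hs⟩ := ih (t := fun j => t j.succ) (fun k => S (k + 1)) c (fun j => ht j.succ)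
      (fun j j' hj => matching j.succ j'.succ (by simp [hj])) (fun j => south j.succ)
      (fun j hj => (matching 0 j.succ (by simp [hj])).symm.trans (hbc.touches_iff .E))
    refine ⟨consSeq a H, consSeq b N, rfl, fun j => Fin.cases ?_ hs j⟩
    rw [← hH] at hbc
    exact hbc

theorem exists_strands_row_east {n : ℕ} {t : Fin n → Tile} (S : ℕ → WithTop ι) (a : WithTop ι)
    (ht : ∀ j, (t j).Allowed .east)
    (matching : ∀ j j' : Fin n, j'.val = j.val + 1 → ((t j).Touches .E ↔ (t j').Touches .W))
    (south : ∀ j, (t j).Touches .S ↔ S j ≠ ⊤)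
    (east : ∀ j : Fin n, j.val + 1 = n → ((t j).Touches .E ↔ a ≠ ⊤)) :
    ∃ H N : ℕ → WithTop ι, H n = a ∧ ∀ j : Fin n, Strands (t j) (rowLabels H S N j) := by
  induction n generalizing S with
  | zero => exact ⟨fun _ => a, fun _ => ⊤, rfl, fun j => j.elim0⟩
  | succ n ih =>
    obtain ⟨H, N, hH, hs⟩ := ih (t := fun j => t j.succ) (fun k => S (k + 1)) (fun j => ht j.succ)
      (fun j j' hj => matching j.succ j'.succ (by simp [hj])) (fun j => south j.succ)
      (fun j hj => east j.succ (by simp [hj]))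
    have hE : (t 0).Touches .E ↔ H 0 ≠ ⊤ := by
      cases n with
      | zero => rw [hH, east 0 rfl]
      | succ n => rw [matching 0 1 rfl]; exact (hs 0).touches_iff .W
    obtain ⟨b, c, hbc⟩ := exists_strands_east (ht 0) (south 0) hE
    exact ⟨consSeq b H, consSeq c N, hH, fun j => Fin.cases hbc hs j⟩

theorem exists_isRowLabelling {n : ℕ} (hn : 0 < n) {b : RowType} {t : Fin n → Tile} (a : ι)
    (S : ℕ → WithTop ι) (ht : ∀ j, (t j).Allowed b)
    (matching : ∀ j j' : Fin n, j'.val = j.val + 1 → ((t j).Touches .E ↔ (t j').Touches .W))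
    (south : ∀ j, (t j).Touches .S ↔ S j ≠ ⊤)
    (west : ∀ j : Fin n, j.val = 0 → ((t j).Touches .W ↔ b = .west))
    (east : ∀ j : Fin n, j.val + 1 = n → ((t j).Touches .E ↔ b = .east)) :
    ∃ H N, IsRowLabelling b a t H S N := by
  cases b
  · obtain ⟨H, N, hH, hs⟩ := exists_strands_row_west S (a : WithTop ι) ht matching south
      (by simpa using west)
    have hlast : n - 1 + 1 = n := Nat.sub_add_cancel hn
    have hE := (hs ⟨n - 1, by omega⟩).touches_iff .E
    rw [east _ hlast] at hE
    refine ⟨H, N, fun j => ⟨ht j, hs j⟩, hH, ?_⟩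
    simpa [rowLabels, sideLabels, hlast, RowType.eastEnd] using hE
  · obtain ⟨H, N, hH, hs⟩ := exists_strands_row_east S (a : WithTop ι) ht matching south
      (by simpa using east)
    have hW := (hs ⟨0, hn⟩).touches_iff .W
    rw [west _ rfl] at hW
    refine ⟨H, N, fun j => ⟨ht j, hs j⟩, ?_, hH⟩
    simpa [rowLabels, sideLabels, RowType.westEnd] using hW

variable {m n : ℕ} {β : Fin m → RowType} {D : Filling m n}

theorem IsHybridPipeDream.exists_isRowLabelling_of_le (hD : IsHybridPipeDream β D)
    (hn : 0 < m → 0 < n) (lab : Fin m → ι) {i : ℕ} (hi : i ≤ m) :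
    ∃ h v : ℕ → ℕ → WithTop ι,
      (∀ r : Fin m, i ≤ r → IsRowLabelling (β r) (lab r) (D r) (h r) (v (r + 1)) (v r)) ∧
        ∀ j : Fin n, v m j = ⊤ := by
  induction hi using Nat.decreasingInduction with
  | self =>
    exact ⟨fun _ _ => ⊤, fun _ _ => ⊤, fun r hr => absurd r.isLt hr.not_gt, fun _ => rfl⟩
  | of_succ i hi ih =>
    obtain ⟨h, v, hrow, hv⟩ := ih
    have south : ∀ j, (D ⟨i, hi⟩ j).Touches .S ↔ v (i + 1) j ≠ ⊤ := by
      intro j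
      obtain hm | hm := Nat.eq_or_lt_of_le hi
      · rw [show i + 1 = m from hm, hv j]
        exact iff_of_false (hD.south_end _ j hm) (not_not.2 rfl)
      · rw [hD.matching .S ⟨i, hi⟩ j ⟨i + 1, hm⟩ j ⟨rfl, rfl⟩]
        exact ((hrow ⟨i + 1, hm⟩ le_rfl).cell j).2.touches_iff .N
    obtain ⟨H, N, hHN⟩ := exists_isRowLabelling (hn (by omega)) (lab ⟨i, hi⟩) (v (i + 1))
      (hD.allowed _) (fun j j' hj => hD.matching .E _ j _ j' ⟨rfl, hj⟩) south (hD.west_end _)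
      (hD.east_end _)
    refine ⟨Function.update h i H, Function.update v i N, fun r hr => ?_, fun j => ?_⟩
    · rw [Function.update_of_ne (by omega : r.val + 1 ≠ i)]
      obtain hir | hir := Nat.eq_or_lt_of_le hr
      · obtain rfl : ⟨i, hi⟩ = r := Fin.ext hir
        simpa using hHN
      · rw [Function.update_of_ne (by omega), Function.update_of_ne (by omega)]
        exact hrow r hir
    · rw [Function.update_of_ne (by omega), hv]

theorem IsHybridPipeDream.exists_isLabelling (hD : IsHybridPipeDream β D) (hn : 0 < m → 0 < n)
    (lab : Fin m → ι) : ∃ h v, IsLabelling β lab D h v := by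
  obtain ⟨h, v, hrow, hv⟩ := hD.exists_isRowLabelling_of_le hn lab (Nat.zero_le m)
  exact ⟨h, v, fun r => hrow r (Nat.zero_le _), hv⟩

end Existence

/-! ### The numbers of the pipes -/

section PipeNumber

variable {m : ℕ}

theorem entersBefore_iff {β : Fin m → RowType} {a b : Fin m} :
    EntersBefore β a b ↔ (β a = .west ∧ β b = .west ∧ a < b) ∨ (β a = .west ∧ β b = .east) ∨
      (β a = .east ∧ β b = .east ∧ b < a) := by
  unfold EntersBefore
  cases β a <;> cases β b <;> simp

theorem EntersBefore.trans {β : Fin m → RowType} {a b c : Fin m} (hab : EntersBefore β a b)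
    (hbc : EntersBefore β b c) : EntersBefore β a c := by
  rw [entersBefore_iff] at *
  grind

open Classical in
theorem val_pipeNumber (β : Fin m → RowType) (r : Fin m) :
    (pipeNumber β r).val = #{r' | EntersBefore β r' r} := rfl

theorem EntersBefore.pipeNumber_lt {β : Fin m → RowType} {a b : Fin m} (h : EntersBefore β a b) :
    pipeNumber β a < pipeNumber β b := by
  classical
  rw [Fin.lt_def, val_pipeNumber, val_pipeNumber]
  refine card_lt_card ((ssubset_iff_of_subset fun c hc => ?_).2 ⟨a, ?_, ?_⟩)
  · simp only [mem_filter, mem_univ, true_and] at hc ⊢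
    exact hc.trans h
  · simpa using h
  · simpa using not_entersBefore_self β a

theorem isEntryOrder_pipeNumber (β : Fin m → RowType) :
    IsEntryOrder β fun i => (pipeNumber β i).val := by
  refine fun i r hir => ⟨fun hβ => EntersBefore.pipeNumber_lt ?_,
    fun hβ => EntersBefore.pipeNumber_lt ?_⟩ <;>
  · rw [entersBefore_iff]
    cases hr : β r <;> simp [hβ, hir]

theorem pipeNumber_zero (β : Fin (m + 1) → RowType) :
    (pipeNumber β 0).val = if β 0 = .west then 0 else m := by
  classical
  rw [val_pipeNumber, Fin.card_filter_univ_succ, if_neg (not_entersBefore_self β 0)]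
  have succ_before : ∀ r : Fin m, EntersBefore β r.succ 0 ↔ β 0 = .east := by
    intro r
    cases hβ : β 0 <;> cases hr : β r.succ <;> simp [entersBefore_iff, hβ, hr]
  simp only [succ_before]
  cases hβ : β 0 <;> simp

theorem pipeNumber_succ (β : Fin (m + 1) → RowType) (i : Fin m) :
    (pipeNumber β i.succ).val =
      (if β 0 = .west then 1 else 0) + (pipeNumber (fun i => β i.succ) i).val := by
  classical
  have zero_before : EntersBefore β 0 i.succ ↔ β 0 = .west := by
    cases hβ : β 0 <;> cases hr : β i.succ <;> simp [entersBefore_iff, hβ, hr]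
  have succ_before : ∀ r : Fin m,
      EntersBefore β r.succ i.succ ↔ EntersBefore (fun i => β i.succ) r i := by
    simp [entersBefore_iff]
  simp only [val_pipeNumber, Fin.card_filter_univ_succ, zero_before, succ_before]
  split_ifs <;> omega

theorem isNumbered_ofFn (β : Fin m → RowType) (a : ℕ) :
    IsNumbered a (List.ofFn fun i => (β i, a + (pipeNumber β i).val)) := by
  induction m generalizing a with
  | zero => trivial
  | succ m ih =>
    simp only [List.ofFn_succ, pipeNumber_zero, pipeNumber_succ]
    cases hβ : β 0
    · exact ⟨by simp, by simpa [add_assoc] using ih (fun i => β i.succ) (a + 1)⟩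
    · exact ⟨by simp, by simpa using ih (fun i => β i.succ) a⟩

end PipeNumber

/-! ### Pipe dreams and labellings -/

section PipeDreams

variable {m n : ℕ} {β : Fin m → RowType} {D : Filling m n}

theorem IsLabelling.isHybridPipeDream {ι : Type*} [LinearOrder ι] {lab : Fin m → ι}
    {h v : ℕ → ℕ → WithTop ι} (H : IsLabelling β lab D h v) (hlab : IsEntryOrder β lab)
    (huncrossed : IsUncrossed β D h v) : IsHybridPipeDream β D := by
  have touches_iff : ∀ i j s, (D i j).Touches s ↔ cellLabels h v i j s ≠ ⊤ := fun i j =>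
    ((H.row i).cell j).2.touches_iff
  refine ⟨fun i j => ((H.row i).cell j).1, fun s i j i' j' hN => ?_, fun i j hj => ?_,
    fun i j hj => ?_, fun i j hi => ?_, (H.no_double_crossing_iff hlab).2 huncrossed⟩
  · rw [touches_iff, touches_iff, cellLabels_of_neighbor hN]
  · have west := (H.row i).west
    cases hβ : β i <;>
      simp [touches_iff, cellLabels, rowLabels, sideLabels, hj, west, RowType.westEnd, hβ]
  · have east := (H.row i).east
    cases hβ : β i <;>
      simp [touches_iff, cellLabels, rowLabels, sideLabels, hj, east, RowType.eastEnd, hβ]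
  · simp [touches_iff, cellLabels, rowLabels, sideLabels, hi, H.south j]

theorem permState_minimalExtension (hmn : m ≤ n) (π : Fin m ↪ Fin n) (k : Fin m) :
    permState (minimalExtension π) m (π k) = WithTop.some k.val := by
  rw [← minimalExtension_castLE hmn, permState_apply, Fin.val_castLE, if_pos k.isLt]

theorem IsLabelling.hasConnectivity_iff {h v : ℕ → ℕ → WithTop ℕ}
    (H : IsLabelling β (fun i => (pipeNumber β i).val) D h v) (hmn : m ≤ n) (π : Fin m ↪ Fin n) :
    HasConnectivity β D π ↔ ∀ c : Fin n, v 0 c = permState (minimalExtension π) m c := by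
  have hlab := isEntryOrder_pipeNumber β
  have exits : HasConnectivity β D π ↔
      ∀ r, v 0 (π (pipeNumber β r)) = WithTop.some (pipeNumber β r).val :=
    forall_congr' fun r => H.exitsAt_iff hlab.injective r _
  rw [exits]
  refine ⟨fun hv c => ?_, fun hv r => by rw [hv, permState_minimalExtension hmn]⟩
  have surj : Function.Surjective (pipeNumber β) :=
    Finite.surjective_of_injective hlab.injective.of_comp
  by_cases hc : v 0 c = ⊤
  · rw [hc, permState, if_neg]
    intro hlt
    obtain ⟨r, hr⟩ := surj ⟨_, hlt⟩
    have hcr : c = π (pipeNumber β r) := by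
      rw [← minimalExtension_castLE hmn, hr]
      exact (Equiv.apply_symm_apply _ c).symm
    rw [hcr, hv] at hc
    exact WithTop.coe_ne_top hc
  · obtain ⟨r, hr⟩ := H.exists_north_eq hlab hc
    rw [hr, H.north_injective hlab hr (hv r), permState_minimalExtension hmn]

theorem isHybridPipeDream_and_hasConnectivity_iff (hmn : m ≤ n) (π : Fin m ↪ Fin n) :
    IsHybridPipeDream β D ∧ HasConnectivity β D π ↔
      HasUncrossedLabelling β (fun i => (pipeNumber β i).val) D
        (List.ofFn (permState (minimalExtension π) m)) := by
  have hlab := isEntryOrder_pipeNumber β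
  simp only [HasUncrossedLabelling, List.ofFn_inj, funext_iff]
  constructor
  · rintro ⟨hD, hπ⟩
    obtain ⟨h, v, H⟩ := hD.exists_isLabelling (fun hm => (π ⟨0, hm⟩).pos) _
    exact ⟨h, v, H, (H.no_double_crossing_iff hlab).1 hD.no_double_crossing,
      (H.hasConnectivity_iff hmn π).1 hπ⟩
  · rintro ⟨h, v, H, huncrossed, hv⟩
    exact ⟨H.isHybridPipeDream hlab huncrossed, (H.hasConnectivity_iff hmn π).2 hv⟩

theorem rename_tileWeight (hmn : m ≤ n) (i : Fin m) (j : Fin n) (t : Tile) :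
    MvPolynomial.rename (Sum.map (Fin.castLE hmn) id) (tileWeight β i j t) =
      cellWeight (β i) (xSeq n (pipeNumber β i) - ySeq n j) t := by
  rw [← Fin.val_castLE hmn (pipeNumber β i), xSeq_val, ySeq_val]
  unfold tileWeight cellWeight
  cases β i <;> simp only <;> split_ifs <;> simp

end PipeDreams

end HybridPipeDream

open HybridPipeDream in
theorem mainTheorem9 (m n : ℕ) (hmn : m ≤ n) (β : Fin m → HybridPipeDream.RowType)
    (π : Fin m ↪ Fin n) :
    MvPolynomial.rename (Sum.map (Fin.castLE hmn) id) (HybridPipeDream.pipeDreamSum β π) =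
      DoubleSchubert.doubleSchubert (HybridPipeDream.minimalExtension π) := by
  classical
  have numbered : IsNumbered 0 (List.ofFn fun i => (β i, (pipeNumber β i).val)) := by
    simpa only [zero_add] using isNumbered_ofFn β 0
  rw [← partitionFn_minimalExtension hmn π _ List.length_ofFn numbered,
    partitionFn_eq_sum _ _ _ _ _ List.length_ofFn, pipeDreamSum, map_sum, sum_filter]
  refine sum_congr rfl fun D _ => ?_
  simp only [isHybridPipeDream_and_hasConnectivity_iff hmn, mul_ite, mul_one, mul_zero, map_prod,
    rename_tileWeight hmn]
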